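/- \textbf{Parallel Moves Lemma.} Let $\Sigma$ be a finite first-order signature and $\mathcal{X}$ a countably infinite set of variables. Terms are finite or infinite: a term is a partial map $t : \mathbb{N}^* \rightharpoonup \Sigma \cup \mathcal{X}$ defined at the root and such that $t(pi)$ is defined if and only if $t(p)$ is a function symbol of arity $n$ and $i$ is one of its $n$ argument indices; the depth of a position is its length. The distance of two distinct terms is $2^{-k}$, where $k$ is the least depth at which they differ. An iTRS $\mathcal{R}$ over $\Sigma$ is a finite set of rules $\ell \to r$, where $\ell$ is a finite term that is not a variable, $r$ is a finite or infinite term, and every variable of $r$ occurs in $\ell$; a rule is collapsing if $r$ is a variable. $\mathcal{R}$ is weakly orthogonal if all left-hand sides are linear and every critical pair $\langle t, s\rangle$ is trivial, i.e. $t = s$. A (strongly convergent) rewrite sequence $s \to^\alpha t$ of ordinal length $\alpha$ consists of terms $(t_\beta)_{\beta \le \alpha}$ with $t_0 = s$, $t_\alpha = t$, and rewrite steps $t_\beta \to t_{\beta+1}$ at positions $p_\beta$ for $\beta < \alpha$, such that for every limit ordinal $\lambda \le \alpha$, as $\beta$ approaches $\lambda$ from below, $t_\beta$ converges to $t_\lambda$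 and the depth of $p_\beta$ tends to infinity. We write $s \to^{\le \omega} t$ if $\alpha \le \omega$. A redex in $t$ is a pair of a position $p$ and a rule $\ell \to r$ such that $t|_p$ is an instance of $\ell$. A parallel step $\phi : t \rightrightarrows t'$ with respect to a finite or infinite set $U$ of redexes in $t$ at pairwise disjoint positions is a complete development of $U$: label in $t$ the root symbol of each redex in $U$ with its rule; the resulting term reduces, by a strongly convergent rewrite sequence with the rules $\ell^{\rho} \to r$ for $\rho : \ell \to r$ in $\mathcal{R}$, where $\ell^\rho$ is $\ell$ with its root symbol labelled by $\rho$, to the term $t'$, which has no labels. The minimal depth $d_\kappa$ of a rewrite sequence $\kappa$, and $d_\phi$ of a parallel step $\phi$, is the minimum of the depths of the contracted redexes, and $\infty$ if there are none. Let $\mathcal{R}$ be a weakly orthogonal iTRS, $\kappa : s \to^\alpha t_1$ a rewrite sequence and $\phi : s \rightrightarrows t_2$ a parallel step. Then there exist a term $u$, a rewrite sequence $\xi : t_2 \to^{\le \omega} u$ and a parallel step $\psi : t_1 \rightrightarrows u$ such that \[ d_\xi \ge \min(d_\kappa, d_\phi) \quad\text{and}\quad d_\psi \ge \min(d_\kappa,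 d_\phi), \] and if, additionally, $\mathcal{R}$ contains no collapsing rules, then \[ d_\xi \ge \min(d_\kappa, d_\phi + 1) \quad\text{and}\quad d_\psi \ge \min(d_\phi, d_\kappa + 1). \] -/

import Mathlib

universe u v w

section

/-! ### Finite and infinite terms -/

/-- The (possibly infinite) terms over the signature with symbols `F` and arities `ar`, and over the
variables `X`: partial maps from positions (words over `ℕ`) to `F ∪ X` that are defined at the root,
and such that `p i` is a position iff `p` carries a function symbol of arity `> i`
(arguments are numbered `0, …, n - 1`). -/
@[ext]
structure ITerm {F : Type u} (ar : F → ℕ) (X : Type v) where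
  toFun : List ℕ → Option (F ⊕ X)
  root_isSome : (toFun []).isSome
  isSome_iff : ∀ (p : List ℕ) (i : ℕ),
    (toFun (p ++ [i])).isSome ↔ ∃ f, toFun p = some (Sum.inl f) ∧ i < ar f

variable {F : Type u} {ar : F → ℕ} {X : Type v}

namespace ITerm

instance : CoeFun (ITerm ar X) (fun _ => List ℕ → Option (F ⊕ X)) := ⟨ITerm.toFun⟩

/-- The set of positions of a term. -/
def pos (t : ITerm ar X) : Set (List ℕ) := {p | (t p).isSome}

/-- The set of variables that occur in a term. -/
def vars (t : ITerm ar X) : Set X := {x | ∃ p, t p = some (Sum.inr x)}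

/-- A term is linear if no variable has two occurrences in it. -/
def Linear (t : ITerm ar X) : Prop :=
  ∀ p q x, t p = some (Sum.inr x) → t q = some (Sum.inr x) → p = q

/-- The term that consists of a single variable. -/
def var (x : X) : ITerm ar X where
  toFun p := match p with
    | [] => some (Sum.inr x)
    | _ :: _ => none
  root_isSome := rfl
  isSome_iff p i := by cases p <;> simp

/-- Replacing the function symbol `f` at position `p` by the symbol `g p f` of the same arity. -/
def relabel {F' : Type*} {ar' : F' → ℕ} (t : ITerm ar X) (g : List ℕ → F → F')
    (hg : ∀ p f, ar' (g p f) = ar f) : ITerm ar' X where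
  toFun p := (t p).map (Sum.map (g p) id)
  root_isSome := by simpa using t.root_isSome
  isSome_iff p i := by
    rw [Option.isSome_map, t.isSome_iff]
    rcases h : t.toFun p with _ | f | x <;> simp [hg]

/-- A position is a position of every prefix. -/
theorem isSome_of_append (t : ITerm ar X) (p q : List ℕ) (h : (t (p ++ q)).isSome) :
    (t p).isSome := by
  induction q using List.reverseRecOn with
  | nil => simpa using h
  | append_singleton q i ih =>
    rw [← List.append_assoc, t.isSome_iff] at h
    obtain ⟨f, hf, -⟩ := h
    exact ih (by simp [hf])

open scoped Classical in
/-- The subterm `t|_p` at a position `p` of `t` (and `t` itself if `p` is not a position of `t`). -/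
noncomputable def subterm (t : ITerm ar X) (p : List ℕ) : ITerm ar X :=
  if hp : p ∈ t.pos then
    { toFun := fun q => t (p ++ q)
      root_isSome := by simpa [pos] using hp
      isSome_iff := fun q i => by rw [← List.append_assoc, t.isSome_iff] }
  else t

open scoped Classical in
/-- The term `t[u]_p` obtained from `t` by replacing the subterm at the position `p` of `t` by `u`
(and `t` itself if `p` is not a position of `t`). -/
noncomputable def replaceAt (t : ITerm ar X) (p : List ℕ) (u : ITerm ar X) : ITerm ar X :=
  if hp : p ∈ t.pos then
    { toFun := fun q => if p <+: q then u (q.drop p.length) else t q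
      root_isSome := by
        by_cases h : p <+: []
        · simpa [h] using u.root_isSome
        · simpa [h] using t.root_isSome
      isSome_iff := fun q i => by
        by_cases h : p <+: q
        · obtain ⟨r, rfl⟩ := h
          have h' : p <+: (p ++ r) ++ [i] := ⟨r ++ [i], by simp⟩
          simp only [h', if_true, List.prefix_append]
          simpa using u.isSome_iff r i
        · by_cases h' : p <+: q ++ [i]
          · have hpq : p = q ++ [i] := by
              rcases List.prefix_concat_iff.1 h' with h'' | h''
              · simpa using h''
              · exact absurd h'' h
            subst hpq
            simp only [h', h, if_true, if_false]
            have := (t.isSome_iff q i).1 hp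
            simpa using iff_of_true u.root_isSome this
          · simp only [h, h', if_false]
            exact t.isSome_iff q i }
  else t

/-- The map underlying `t.subst σ`: walk down `t` along the position; once a variable `x` is met,
continue in `σ x`. -/
def substFun {Y : Type*} (σ : X → ITerm ar Y) :
    List ℕ → (List ℕ → Option (F ⊕ X)) → Option (F ⊕ Y)
  | [], t => match t [] with
    | none => none
    | some (Sum.inl f) => some (Sum.inl f)
    | some (Sum.inr x) => σ x []
  | i :: p, t => match t [] with
    | none => none
    | some (Sum.inl _) => substFun σ p (fun q => t (i :: q))
    | some (Sum.inr x) => σ x (i :: p)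

/-- Applying the substitution `σ` to the term `t`. -/
def subst {Y : Type*} (t : ITerm ar X) (σ : X → ITerm ar Y) : ITerm ar Y where
  toFun p := substFun σ p t
  root_isSome := by
    have := t.root_isSome
    rcases h : t.toFun [] with _ | f | x
    · simp [h] at this
    · simp [substFun, h]
    · simpa [substFun, h] using (σ x).root_isSome
  isSome_iff p i := by
    have key : ∀ (p : List ℕ) (t : List ℕ → Option (F ⊕ X)),
        (∀ (p : List ℕ) (i : ℕ), (t (p ++ [i])).isSome ↔
          ∃ f, t p = some (Sum.inl f) ∧ i < ar f) →
        ((substFun σ (p ++ [i]) t).isSome ↔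
          ∃ f, substFun σ p t = some (Sum.inl f) ∧ i < ar f) := by
      intro p
      induction p with
      | nil =>
        intro t ht
        have h0 := ht [] i
        rcases h : t [] with _ | f | x
        · simp [substFun, h]
        · have h0' : (t [i]).isSome ↔ i < ar f := by simpa [h] using h0
          have h1 : (∃ g, (some (Sum.inl f) : Option (F ⊕ Y)) = some (Sum.inl g) ∧ i < ar g) ↔
              i < ar f := by simp
          simp only [List.nil_append, substFun, h]
          rw [h1, ← h0']
          rcases h1 : t [i] with _ | f | x
          · simp
          · simp
          · simpa using (σ x).root_isSome
        · simpa [substFun, h] using (σ x).isSome_iff [] i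
      | cons j p ih =>
        intro t ht
        rcases h : t [] with _ | f | x
        · simp [substFun, h]
        · simp only [List.cons_append, substFun, h]
          exact ih (fun q => t (j :: q)) (fun q k => ht (j :: q) k)
        · simpa [substFun, h] using (σ x).isSome_iff (j :: p) i
    exact key p t t.isSome_iff

open scoped Classical in
/-- The metric on terms: `2⁻ᵏ` for distinct terms, where `k` is the least length of a position at
which they differ. -/
noncomputable def distance (s t : ITerm ar X) : ℝ :=
  if s = t then 0 else (2 : ℝ)⁻¹ ^ sInf {k : ℕ | ∃ p : List ℕ, p.length = k ∧ s p ≠ t p}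

end ITerm

/-! ### Infinitary term rewriting systems -/

/-- An infinitary rewrite rule: the left-hand side is a finite term, but not a variable, the
right-hand side is a finite or infinite term, all of whose variables occur on the left. -/
@[ext]
structure IRule {F : Type u} (ar : F → ℕ) (X : Type v) where
  lhs : ITerm ar X
  rhs : ITerm ar X
  lhs_finite : lhs.pos.Finite
  lhs_root : ∃ f, lhs [] = some (Sum.inl f)
  vars_subset : rhs.vars ⊆ lhs.vars

/-- A rule is collapsing if its right-hand side is a variable. -/
def IRule.Collapsing (ρ : IRule ar X) : Prop := ∃ x, ρ.rhs = ITerm.var x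

/-- An infinitary term rewriting system, with finitely many rules. -/
structure ITRS {F : Type u} (ar : F → ℕ) (X : Type v) where
  rules : Set (IRule ar X)
  rules_finite : rules.Finite

namespace ITRS

/-- `R.StepAt p s t`: the term `s` rewrites to `t` by an application of a rule at position `p`. -/
def StepAt (R : ITRS ar X) (p : List ℕ) (s t : ITerm ar X) : Prop :=
  p ∈ s.pos ∧ ∃ ρ ∈ R.rules, ∃ σ : X → ITerm ar X,
    s.subterm p = ρ.lhs.subst σ ∧ t = s.replaceAt p (ρ.rhs.subst σ)

/-- A strongly convergent transfinite rewrite sequence of length `α` from `s` to `t`. The terms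
`term β` for `β ≤ α` and the positions `stepPos β` for `β < α` are the ones that matter; the depth
of the step from `term β` to `term (β + 1)` is the length of `stepPos β`. At every limit ordinal
`l ≤ α` the terms converge to `term l`, and the depths of the steps tend to infinity. -/
structure RewriteSeq (R : ITRS ar X) (s t : ITerm ar X) (α : Ordinal.{w}) where
  term : Ordinal.{w} → ITerm ar X
  stepPos : Ordinal.{w} → List ℕ
  term_zero : term 0 = s
  term_length : term α = t
  step : ∀ β < α, R.StepAt (stepPos β) (term β) (term (Order.succ β))
  tendsto_term : ∀ l ≤ α, Order.IsSuccLimit l → ∀ ε : ℝ, 0 < ε →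
    ∃ γ < l, ∀ β, γ ≤ β → β < l → (term β).distance (term l) < ε
  tendsto_depth : ∀ l ≤ α, Order.IsSuccLimit l → ∀ d : ℕ,
    ∃ γ < l, ∀ β, γ ≤ β → β < l → d ≤ (stepPos β).length

/-- The minimal depth of a step in a rewrite sequence (`⊤` if there is no step). -/
noncomputable def RewriteSeq.minDepth {R : ITRS ar X} {s t : ITerm ar X} {α : Ordinal.{w}}
    (κ : R.RewriteSeq s t α) : ℕ∞ :=
  ⨅ β : Set.Iio α, ((κ.stepPos β).length : ℕ∞)

/-- `(t, s)` is a critical pair of the rule `ρ₁` with the (inner) rule `ρ₂`: at a position `p` of the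
left-hand side `ℓ₁` that carries a function symbol, `ℓ₁|_p` and `ℓ₂` have a common instance,
`σ (ℓ₁|_p) = τ ℓ₂` is a most general one, the domain of `σ` is the set of variables of `ℓ₁|_p`, the
variables of `σ (ℓ₁|_p)` do not occur in `ℓ₁` outside of `ℓ₁|_p`,
and `t = (σ ℓ₁)[τ r₂]_p`, `s = σ r₁`. -/
def IsCriticalPair (ρ₁ ρ₂ : IRule ar X) (t s : ITerm ar X) : Prop :=
  ∃ (p : List ℕ) (σ τ : X → ITerm ar X),
    (∃ f, ρ₁.lhs p = some (Sum.inl f)) ∧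
    (ρ₁.lhs.subterm p).subst σ = ρ₂.lhs.subst τ ∧
    (∀ σ' τ' : X → ITerm ar X, (ρ₁.lhs.subterm p).subst σ' = ρ₂.lhs.subst τ' →
      ∃ δ : X → ITerm ar X, (ρ₁.lhs.subterm p).subst σ' = ((ρ₁.lhs.subterm p).subst σ).subst δ) ∧
    {x | σ x ≠ ITerm.var x} = (ρ₁.lhs.subterm p).vars ∧
    (∀ x ∈ ((ρ₁.lhs.subterm p).subst σ).vars, ∀ q, ¬ p <+: q → ρ₁.lhs q ≠ some (Sum.inr x)) ∧
    t = (ρ₁.lhs.subst σ).replaceAt p (ρ₂.rhs.subst τ) ∧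
    s = ρ₁.rhs.subst σ

/-- Weak orthogonality: all left-hand sides are linear and all critical pairs are trivial. -/
def WeaklyOrthogonal (R : ITRS ar X) : Prop :=
  (∀ ρ ∈ R.rules, ρ.lhs.Linear) ∧
  ∀ ρ₁ ∈ R.rules, ∀ ρ₂ ∈ R.rules, ∀ t s, IsCriticalPair ρ₁ ρ₂ t s → t = s

/-- None of the rules is collapsing. -/
def NonCollapsing (R : ITRS ar X) : Prop := ∀ ρ ∈ R.rules, ¬ ρ.Collapsing

/-! ### Redexes, multi-steps and parallel steps -/

/-- A redex is a pair of a position and a rule. -/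
abbrev Redex (R : ITRS ar X) := List ℕ × R.rules

/-- `u` is a redex in the term `t`. -/
def IsRedexIn (R : ITRS ar X) (t : ITerm ar X) (u : R.Redex) : Prop :=
  u.1 ∈ t.pos ∧ ∃ σ : X → ITerm ar X, t.subterm u.1 = u.2.1.lhs.subst σ

/-- The pattern of a redex: all positions `p q` with `p` its root and `q` the position of a function
symbol in the left-hand side of its rule. -/
def pattern {R : ITRS ar X} (u : R.Redex) : Set (List ℕ) :=
  {p | ∃ q f, u.2.1.lhs q = some (Sum.inl f) ∧ p = u.1 ++ q}

/-- A multi-redex in `t` is a set of pairwise non-overlapping redexes in `t`. -/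
def IsMultiRedex (R : ITRS ar X) (t : ITerm ar X) (U : Set R.Redex) : Prop :=
  (∀ u ∈ U, R.IsRedexIn t u) ∧ ∀ u ∈ U, ∀ v ∈ U, u ≠ v → Disjoint (pattern u) (pattern v)

/-- The symbols of the labelled system: the symbols `f`, and the symbols `f` labelled with a rule. -/
abbrev LabelledSymbol (R : ITRS ar X) := F ⊕ F × R.rules

/-- Labelling does not change the arity. -/
def labelledArity (R : ITRS ar X) : R.LabelledSymbol → ℕ :=
  Sum.elim ar (fun fρ => ar fρ.1)

theorem labelledArity_inl (R : ITRS ar X) (f : F) : R.labelledArity (Sum.inl f) = ar f := rfl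

/-- Terms, seen as labelled terms without labels. -/
def unlabelled (R : ITRS ar X) (t : ITerm ar X) : ITerm R.labelledArity X :=
  t.relabel (fun _ f => Sum.inl f) (fun _ f => R.labelledArity_inl f)

open scoped Classical in
/-- The symbol `f` at position `p`, labelled with `ρ` if `p` is the root position. -/
noncomputable def rootLabel (R : ITRS ar X) (ρ : R.rules) (p : List ℕ) (f : F) :
    R.LabelledSymbol :=
  if p = [] then Sum.inr (f, ρ) else Sum.inl f

theorem labelledArity_rootLabel (R : ITRS ar X) (ρ : R.rules) (p : List ℕ) (f : F) :
    R.labelledArity (R.rootLabel ρ p f) = ar f := by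
  unfold rootLabel
  split <;> rfl

/-- The labelled left-hand side: its root symbol is labelled with the rule. -/
noncomputable def labelledLhs (R : ITRS ar X) (ρ : R.rules) : ITerm R.labelledArity X :=
  ρ.1.lhs.relabel (R.rootLabel ρ) (R.labelledArity_rootLabel ρ)

open scoped Classical in
/-- The symbol `f` at position `p`, labelled with `ρ` if `(p, ρ) ∈ U` for some `ρ`.
(In a multi-redex `U` there is at most one such `ρ` for every `p`.) -/
noncomputable def redexLabel {R : ITRS ar X} (U : Set R.Redex) (p : List ℕ) (f : F) :
    R.LabelledSymbol :=
  if h : ∃ ρ, (p, ρ) ∈ U then Sum.inr (f, h.choose) else Sum.inl f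

theorem labelledArity_redexLabel {R : ITRS ar X} (U : Set R.Redex) (p : List ℕ) (f : F) :
    R.labelledArity (redexLabel U p f) = ar f := by
  unfold redexLabel
  split <;> rfl

/-- The term `t^U`: for each redex `(p, ρ) ∈ U` the symbol at position `p` is labelled with `ρ`. -/
noncomputable def labelTerm (R : ITRS ar X) (t : ITerm ar X) (U : Set R.Redex) :
    ITerm R.labelledArity X :=
  t.relabel (redexLabel U) (labelledArity_redexLabel U)

/-- The labelled rule of `ρ : ℓ → r`, from the labelled left-hand side to the unlabelled `r`. -/
noncomputable def labelledRule (R : ITRS ar X) (ρ : R.rules) : IRule R.labelledArity X where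
  lhs := R.labelledLhs ρ
  rhs := R.unlabelled ρ.1.rhs
  lhs_finite := by
    have h : (R.labelledLhs ρ).pos = ρ.1.lhs.pos := by
      ext p
      simp [ITerm.pos, labelledLhs, ITerm.relabel]
    rw [h]
    exact ρ.1.lhs_finite
  lhs_root := by
    obtain ⟨f, hf⟩ := ρ.1.lhs_root
    exact ⟨Sum.inr (f, ρ), by simp [labelledLhs, rootLabel, ITerm.relabel, hf]⟩
  vars_subset := by
    rintro x ⟨p, hp⟩
    have hx : x ∈ ρ.1.rhs.vars := by
      refine ⟨p, ?_⟩
      rcases h : ρ.1.rhs p with _ | f | y <;> simp_all [unlabelled, ITerm.relabel]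
    obtain ⟨q, hq⟩ := ρ.1.vars_subset hx
    exact ⟨q, by simp [labelledLhs, ITerm.relabel, hq]⟩

/-- The labelled rewriting system, with which developments are defined. -/
noncomputable def labelled (R : ITRS ar X) : ITRS R.labelledArity X where
  rules := Set.range R.labelledRule
  rules_finite :=
    have : Finite R.rules := R.rules_finite
    Set.finite_range _

/-- A multi-step from `t` to `t'` with respect to the multi-redex `U`: the labelled term `t^U`
reduces in the labelled system to the term `t'` without labels. (Strongly convergent rewrite
sequences have countable length, whence the choice of universe for the length is immaterial.) -/
def MultiStep (R : ITRS ar X) (U : Set R.Redex) (t t' : ITerm ar X) : Prop :=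
  R.IsMultiRedex t U ∧
  ∃ α : Ordinal.{0}, Nonempty (R.labelled.RewriteSeq (R.labelTerm t U) (R.unlabelled t') α)

/-- A parallel step is a multi-step with respect to a (possibly infinite) set of redexes at pairwise
disjoint positions. -/
def ParallelStep (R : ITRS ar X) (U : Set R.Redex) (t t' : ITerm ar X) : Prop :=
  (∀ u ∈ U, ∀ v ∈ U, u ≠ v → ¬ u.1 <+: v.1 ∧ ¬ v.1 <+: u.1) ∧ R.MultiStep U t t'

/-- The minimal depth of a redex contracted in a parallel step with respect to `U`
(`⊤` if there is none). -/
noncomputable def redexDepth {R : ITRS ar X} (U : Set R.Redex) : ℕ∞ :=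
  ⨅ u : U, (u.1.1.length : ℕ∞)

end ITRS

end

section

variable {F : Type u} {ar : F → ℕ} {X : Type v}

/-! ### Positions, matching and substitution -/

namespace ITerm

/-! Two changes of representation carry the proof. A parallel step is replaced by the pointwise
relation `Contracts U s t`: nothing changes off the redexes, each redex shows its right-hand side,
and below every variable of it hangs the old subterm of `s`. This determines `t`, so no development
has to be carried along. A transfinite sequence is replaced by the inductive relation `Reach d`,
generated by steps of depth at least `d`, composition, and `ω`-limits with depths tending to
infinity.

One step `v` is compared with a parallel step `U` in `Contracts.project`. If `v` overlaps some `u ∈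
U`, triviality of the critical pair makes both contractions equal (`Contracts.eq_of_overlap`): `U \
{u}` remains on one side and nothing on the other. If `v` lies below a variable of some `u ∈ U`,
then `U` survives and `v` turns into a set of parallel copies, possibly infinite since right-hand
sides may be. Otherwise `v` survives, and the redexes of `U` below its variables are moved and
copied. A redex is only ever moved from below a variable of a left-hand side to below the same
variable of the right-hand side. So a copy of `v` loses less than `D` in depth, where `D` bounds the
depths in left-hand sides, and any copied redex stays at least `k` below the contracted one, where
`k` bounds the depths of variables in right-hand sides from below. This gives the bounds `min e (δ +
k)` and `min δ (e + k)`; `k = 0` always works, and `k = 1` works without collapsing rules.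

`Reach.project` iterates this. At a limit, the redex sets are combined along a nonprincipal
ultrafilter (`exists_contracts_limit`), so that they need not be shown to stabilise; the projected
terms do converge, because projecting a segment of depth `E n` yields depth at least `E n - D`.

Compression to length at most `ω` also rests on projection: a step whose redex lies well above a
deep sequence can be moved in front of it (`Reach.exists_finSteps`). The resulting finite
approximations are strung together by `exists_rewriteSeq_of_finSteps`. Finally,
`ParallelStep.contracts` and `Contracts.parallelStep` return to labelled developments, where each
redex of `U` is at any time either intact or completely contracted. -/

theorem ext_apply {s t : ITerm ar X} (h : ∀ p, s p = t p) : s = t :=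
  ITerm.ext (funext h)

theorem exists_fn_of_append_cons (t : ITerm ar X) {p : List ℕ} {i : ℕ} {q : List ℕ}
    (h : (t (p ++ i :: q)).isSome) : ∃ f, t p = some (Sum.inl f) ∧ i < ar f := by
  have h' : (t ((p ++ [i]) ++ q)).isSome := by simpa using h
  exact (t.isSome_iff p i).1 (t.isSome_of_append _ _ h')

theorem eq_none_of_arity_le (t : ITerm ar X) {p : List ℕ} {f : F} {i : ℕ}
    (h : t p = some (Sum.inl f)) (hi : ar f ≤ i) (q : List ℕ) : t (p ++ i :: q) = none := by
  by_contra h'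
  obtain ⟨g, hg, hlt⟩ := t.exists_fn_of_append_cons (Option.isSome_iff_ne_none.2 h')
  rw [h] at hg
  obtain rfl : f = g := by simpa using hg
  omega

/-- Variables are leaves. -/
theorem eq_nil_of_var (t : ITerm ar X) {p q : List ℕ} {x : X} (h : t p = some (Sum.inr x))
    (h' : (t (p ++ q)).isSome) : q = [] := by
  cases q with
  | nil => rfl
  | cons i q =>
    obtain ⟨f, hf, -⟩ := t.exists_fn_of_append_cons h'
    simp [h] at hf

theorem fn_of_prefix_fn (t : ITerm ar X) {p q : List ℕ} {f : F}
    (h : t (p ++ q) = some (Sum.inl f)) : ∃ g, t p = some (Sum.inl g) := by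
  cases q with
  | nil => exact ⟨f, by simpa using h⟩
  | cons i q =>
    obtain ⟨g, hg, -⟩ := t.exists_fn_of_append_cons (p := p) (i := i) (q := q) (by simp [h])
    exact ⟨g, hg⟩

/-- Distinct variable positions are incomparable. This is what keeps copies of a redex below
different variable occurrences disjoint. -/
theorem var_prefix_unique (t : ITerm ar X) {p q a b : List ℕ} {x y : X}
    (hp : t p = some (Sum.inr x)) (hq : t q = some (Sum.inr y)) (h : p ++ a <+: q ++ b) :
    p = q := by
  have h1 : p <+: q ++ b := (List.prefix_append p a).trans h
  rcases List.prefix_or_prefix_of_prefix h1 (List.prefix_append q b) with ⟨c, rfl⟩ | ⟨c, rfl⟩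
  · simp [t.eq_nil_of_var hp (q := c) (by simp [hq])]
  · simp [t.eq_nil_of_var hq (q := c) (by simp [hp])]

/-- Following a word through a term, one stays at function symbols, or passes a variable, or leaves
the term because of the arity of a function symbol. -/
theorem walk_cases (r : ITerm ar X) (a : List ℕ) :
    (∃ f, r a = some (Sum.inl f)) ∨
    (∃ q b x, a = q ++ b ∧ r q = some (Sum.inr x)) ∨
    (∃ c i d f, a = c ++ i :: d ∧ r c = some (Sum.inl f) ∧ ar f ≤ i) := by
  induction a using List.reverseRecOn with
  | nil =>
    have := r.root_isSome
    rcases h : r.toFun [] with _ | f | x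
    · simp [h] at this
    · exact Or.inl ⟨f, rfl⟩
    · exact Or.inr (Or.inl ⟨[], [], x, rfl, h⟩)
  | append_singleton c i ih =>
    rcases ih with ⟨f, hf⟩ | ⟨q, b, x, rfl, hx⟩ | ⟨c, j, d, f, rfl, hf, hj⟩
    · by_cases hi : i < ar f
      · have := (r.isSome_iff c i).2 ⟨f, hf, hi⟩
        rcases h : r.toFun (c ++ [i]) with _ | g | x
        · simp [h] at this
        · exact Or.inl ⟨g, rfl⟩
        · exact Or.inr (Or.inl ⟨c ++ [i], [], x, by simp, h⟩)
      · exact Or.inr (Or.inr ⟨c, i, [], f, rfl, hf, not_lt.1 hi⟩)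
    · exact Or.inr (Or.inl ⟨q, b ++ [i], x, by simp, hx⟩)
    · exact Or.inr (Or.inr ⟨c, j, d ++ [i], f, by simp, hf, hj⟩)

/-- The function symbols of `r` are found in `t` below the position `p`. -/
def Matches (r t : ITerm ar X) (p : List ℕ) : Prop :=
  ∀ q f, r q = some (Sum.inl f) → t (p ++ q) = some (Sum.inl f)

theorem Matches.isSome {r t : ITerm ar X} {p : List ℕ} (h : r.Matches t p) (hp : (t p).isSome)
    {q : List ℕ} (hq : (r q).isSome) : (t (p ++ q)).isSome := by
  induction q using List.reverseRecOn with
  | nil => simpa using hp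
  | append_singleton c i _ =>
    obtain ⟨f, hf, hi⟩ := (r.isSome_iff c i).1 hq
    rw [← List.append_assoc]
    exact (t.isSome_iff _ i).2 ⟨f, h c f hf, hi⟩

theorem Matches.eq_none {r t : ITerm ar X} {p : List ℕ} (h : r.Matches t p) {c d : List ℕ} {i : ℕ}
    {f : F} (hf : r c = some (Sum.inl f)) (hi : ar f ≤ i) : t (p ++ (c ++ i :: d)) = none := by
  rw [← List.append_assoc]
  exact t.eq_none_of_arity_le (h c f hf) hi d

/-- Two terms that match `r` agree where they agree below the variables of `r`. -/
theorem Matches.apply_eq {r s t : ITerm ar X} {p p' : List ℕ} (hs : r.Matches s p)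
    (ht : r.Matches t p') (a : List ℕ)
    (h : ∀ q b x, a = q ++ b → r q = some (Sum.inr x) → s (p ++ (q ++ b)) = t (p' ++ (q ++ b))) :
    s (p ++ a) = t (p' ++ a) := by
  rcases r.walk_cases a with ⟨f, hf⟩ | ⟨q, b, x, rfl, hx⟩ | ⟨c, i, d, f, rfl, hf, hi⟩
  · rw [hs a f hf, ht a f hf]
  · exact h q b x rfl hx
  · rw [hs.eq_none hf hi, ht.eq_none hf hi]

theorem subterm_apply {t : ITerm ar X} {p : List ℕ} (hp : (t p).isSome) (q : List ℕ) :
    t.subterm p q = t (p ++ q) := by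
  simp [subterm, pos, hp]

theorem replaceAt_apply_append {t u : ITerm ar X} {p : List ℕ} (hp : (t p).isSome) (q : List ℕ) :
    t.replaceAt p u (p ++ q) = u q := by
  simp [replaceAt, pos, hp]

theorem replaceAt_apply_of_not_prefix {t u : ITerm ar X} {p : List ℕ} {q : List ℕ}
    (h : ¬ p <+: q) : t.replaceAt p u q = t q := by
  by_cases hp : (t p).isSome <;> simp [replaceAt, pos, hp, h]

section Subst

variable {Y : Type*}

theorem exists_fn_root {t : List ℕ → Option (F ⊕ X)}
    (ht : ∀ p i, (t (p ++ [i])).isSome → ∃ f, t p = some (Sum.inl f)) (i : ℕ) (q : List ℕ)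
    (h : (t (i :: q)).isSome) : ∃ f, t [] = some (Sum.inl f) := by
  induction q using List.reverseRecOn with
  | nil => exact ht [] i (by simpa using h)
  | append_singleton q j ih =>
    obtain ⟨f, hf⟩ := ht (i :: q) j (by simpa using h)
    exact ih (by simp [hf])

theorem substFun_of_var (σ : X → ITerm ar Y) {x : X} (b : List ℕ) (q : List ℕ) :
    ∀ t : List ℕ → Option (F ⊕ X),
      (∀ p i, (t (p ++ [i])).isSome → ∃ f, t p = some (Sum.inl f)) →
      t q = some (Sum.inr x) → substFun σ (q ++ b) t = σ x b := by
  induction q with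
  | nil =>
    intro t _ h
    cases b <;> simp [substFun, h]
  | cons i q ih =>
    intro t ht h
    obtain ⟨f, hf⟩ := exists_fn_root ht i q (by simp [h])
    simp only [List.cons_append, substFun, hf]
    exact ih (fun r => t (i :: r)) (fun r j hr => ht (i :: r) j hr) h

theorem substFun_of_fn (σ : X → ITerm ar Y) {f : F} (q : List ℕ) :
    ∀ t : List ℕ → Option (F ⊕ X),
      (∀ p i, (t (p ++ [i])).isSome → ∃ f, t p = some (Sum.inl f)) →
      t q = some (Sum.inl f) → substFun σ q t = some (Sum.inl f) := by
  induction q with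
  | nil =>
    intro t _ h
    simp [substFun, h]
  | cons i q ih =>
    intro t ht h
    obtain ⟨g, hg⟩ := exists_fn_root ht i q (by simp [h])
    simp only [substFun, hg]
    exact ih (fun r => t (i :: r)) (fun r j hr => ht (i :: r) j hr) h

theorem substFun_congr (σ : X → ITerm ar Y) (q : List ℕ) :
    ∀ s t : List ℕ → Option (F ⊕ X), (∀ c, c <+: q → s c = t c) →
      substFun σ q s = substFun σ q t := by
  induction q with
  | nil =>
    intro s t h
    simp [substFun, h [] (List.prefix_refl _)]
  | cons i q ih =>
    intro s t h
    simp only [substFun, h [] List.nil_prefix]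
    rw [ih (fun r => s (i :: r)) (fun r => t (i :: r))
      (fun c hc => h (i :: c) (by simpa using hc))]

theorem subst_apply_var (t : ITerm ar X) (σ : X → ITerm ar Y) {q : List ℕ} {x : X}
    (h : t q = some (Sum.inr x)) (b : List ℕ) : t.subst σ (q ++ b) = σ x b :=
  substFun_of_var σ b q t.toFun
    (fun p i hp => ((t.isSome_iff p i).1 hp).imp fun _ h => h.1) h

theorem subst_apply_fn (t : ITerm ar X) (σ : X → ITerm ar Y) {q : List ℕ} {f : F}
    (h : t q = some (Sum.inl f)) : t.subst σ q = some (Sum.inl f) :=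
  substFun_of_fn σ q t.toFun
    (fun p i hp => ((t.isSome_iff p i).1 hp).imp fun _ h => h.1) h

theorem subst_apply_congr {s t : ITerm ar X} (σ : X → ITerm ar Y) {q : List ℕ}
    (h : ∀ c, c <+: q → s c = t c) : s.subst σ q = t.subst σ q :=
  substFun_congr σ q s.toFun t.toFun h

theorem var_subst (x : X) (σ : X → ITerm ar Y) : (var x : ITerm ar X).subst σ = σ x :=
  ext_apply fun p => subst_apply_var (var x) σ (q := []) rfl p

end Subst

theorem matches_subst (r : ITerm ar X) (σ : X → ITerm ar X) : r.Matches (r.subst σ) [] :=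
  fun _ _ h => subst_apply_fn r σ h

theorem subterm_subst {t : ITerm ar X} {p : List ℕ} (hp : (t p).isSome) (σ : X → ITerm ar X)
    (q : List ℕ) : (t.subterm p).subst σ q = t.subst σ (p ++ q) := by
  have h1 : (t.subterm p).Matches ((t.subterm p).subst σ) [] := matches_subst _ σ
  have h2 : (t.subterm p).Matches (t.subst σ) p := fun q f hq => by
    rw [subterm_apply hp] at hq
    exact subst_apply_fn t σ hq
  refine h1.apply_eq h2 q fun q b x _ hx => ?_
  rw [List.nil_append, subst_apply_var _ σ hx, ← List.append_assoc, subst_apply_var t σ]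
  rwa [subterm_apply hp] at hx

open scoped Classical in
/-- The substitution that maps the variables of `r` to the subterms of `t` at their positions, and
is equal to `d` on the other variables. -/
noncomputable def matchSubst (r t : ITerm ar X) (d : X → ITerm ar X) (x : X) : ITerm ar X :=
  if h : ∃ q, r q = some (Sum.inr x) then t.subterm h.choose else d x

theorem matchSubst_of_var {r : ITerm ar X} (hr : r.Linear) (t : ITerm ar X) (d : X → ITerm ar X)
    {q : List ℕ} {x : X} (h : r q = some (Sum.inr x)) : r.matchSubst t d x = t.subterm q := by
  have h' : ∃ q, r q = some (Sum.inr x) := ⟨q, h⟩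
  rw [matchSubst, dif_pos h', hr _ _ x h'.choose_spec h]

theorem matchSubst_of_notMem {r : ITerm ar X} (t : ITerm ar X) (d : X → ITerm ar X)
    {x : X} (h : x ∉ r.vars) : r.matchSubst t d x = d x :=
  dif_neg h

/-- For a linear term, agreement on function symbols already makes `t` an instance: no two
occurrences of a variable have to be compared. All later arguments about redexes therefore use
`Matches`. -/
theorem subst_matchSubst {r t : ITerm ar X} (hr : r.Linear) (h : r.Matches t [])
    (d : X → ITerm ar X) : r.subst (r.matchSubst t d) = t := by
  refine ext_apply fun a => ?_
  refine (matches_subst r (r.matchSubst t d)).apply_eq h a fun q b x _ hx => ?_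
  rw [List.nil_append, subst_apply_var r _ hx, matchSubst_of_var hr t d hx, subterm_apply]
  exact h.isSome t.root_isSome (by simp [hx])

theorem subst_matchSubst_apply {r t l : ITerm ar X} (hl : l.Linear) (h : l.Matches t [])
    (d : X → ITerm ar X) {q q₀ : List ℕ} {x : X} (hq : r q = some (Sum.inr x))
    (hq₀ : l q₀ = some (Sum.inr x)) (b : List ℕ) :
    r.subst (l.matchSubst t d) (q ++ b) = t (q₀ ++ b) := by
  rw [subst_apply_var r _ hq, matchSubst_of_var hl t d hq₀, subterm_apply]
  exact h.isSome t.root_isSome (by simp [hq₀])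

theorem matches_subterm {r t : ITerm ar X} {p : List ℕ} (hp : (t p).isSome) (h : r.Matches t p) :
    r.Matches (t.subterm p) [] := fun q f hq => by
  rw [subterm_apply hp]; exact h q f hq

end ITerm

theorem IRule.exists_lhs_var (ρ : IRule ar X) {q : List ℕ} {x : X}
    (h : ρ.rhs q = some (Sum.inr x)) : ∃ q₀, ρ.lhs q₀ = some (Sum.inr x) :=
  ρ.vars_subset ⟨q, h⟩

/-! ### Contraction of disjoint redexes, described position by position -/

namespace ITRS

/-- All left-hand sides are linear. -/
def LeftLinear (R : ITRS ar X) : Prop := ∀ ρ ∈ R.rules, ρ.lhs.Linear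

/-- `t` is the result of contracting the redexes in `U`, at pairwise disjoint positions of `s`. -/
structure Contracts (R : ITRS ar X) (U : Set R.Redex) (s t : ITerm ar X) : Prop where
  antichain : ∀ u ∈ U, ∀ v ∈ U, u.1 <+: v.1 → u = v
  lhs_matches : ∀ u ∈ U, u.2.1.lhs.Matches s u.1
  outside : ∀ q, (∀ u ∈ U, ¬ u.1 <+: q) → t q = s q
  rhs_matches : ∀ u ∈ U, u.2.1.rhs.Matches t u.1
  inside : ∀ u ∈ U, ∀ q₀ q x, u.2.1.lhs q₀ = some (Sum.inr x) → u.2.1.rhs q = some (Sum.inr x) →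
    ∀ w, t (u.1 ++ (q ++ w)) = s (u.1 ++ (q₀ ++ w))

variable {R : ITRS ar X} {s t : ITerm ar X} {U : Set R.Redex}

theorem isSome_of_lhs_matches {ρ : IRule ar X} {p : List ℕ} (h : ρ.lhs.Matches s p) :
    (s p).isSome := by
  obtain ⟨f, hf⟩ := ρ.lhs_root
  have := h [] f hf
  rw [List.append_nil] at this
  simp [this]

theorem prefix_comparable {p q a b : List ℕ} (h : p ++ a <+: q ++ b) : p <+: q ∨ q <+: p :=
  List.prefix_or_prefix_of_prefix ((List.prefix_append p a).trans h) (List.prefix_append q b)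

theorem Contracts.eq_of_comparable (h : R.Contracts U s t) {u v : R.Redex} (hu : u ∈ U)
    (hv : v ∈ U) (huv : u.1 <+: v.1 ∨ v.1 <+: u.1) : u = v :=
  huv.elim (h.antichain u hu v hv) fun h' => (h.antichain v hv u hu h').symm

/-- Each position is off all redexes, or in a right-hand side pattern, or below one of its
variables, and each clause of `Contracts` prescribes the symbol there. -/
theorem Contracts.unique {t' : ITerm ar X} (h : R.Contracts U s t) (h' : R.Contracts U s t') :
    t = t' := by
  refine ITerm.ext_apply fun q => ?_
  by_cases hq : ∃ u ∈ U, u.1 <+: q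
  · obtain ⟨u, hu, a, rfl⟩ := hq
    refine (h.rhs_matches u hu).apply_eq (h'.rhs_matches u hu) a fun q b x _ hx => ?_
    obtain ⟨q₀, hq₀⟩ := u.2.1.exists_lhs_var hx
    rw [h.inside u hu q₀ q x hq₀ hx, h'.inside u hu q₀ q x hq₀ hx]
  · have hq' : ∀ u ∈ U, ¬ u.1 <+: q := fun u hu h' => hq ⟨u, hu, h'⟩
    rw [h.outside q hq', h'.outside q hq']

open scoped Classical in
theorem exists_contracts (hR : R.LeftLinear)
    (ha : ∀ u ∈ U, ∀ v ∈ U, u.1 <+: v.1 → u = v)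
    (hm : ∀ u ∈ U, u.2.1.lhs.Matches s u.1) : ∃ t, R.Contracts U s t := by
  -- The contractum of `u`. The default `ITerm.var` has no effect, as all variables of the
  -- right-hand side occur on the left.
  let c : R.Redex → ITerm ar X := fun u =>
    u.2.1.rhs.subst (u.2.1.lhs.matchSubst (s.subterm u.1) ITerm.var)
  let g : List ℕ → Option (F ⊕ X) := fun q =>
    if h : ∃ u ∈ U, u.1 <+: q then c h.choose (q.drop h.choose.1.length) else s q
  have g_in : ∀ u ∈ U, ∀ a, g (u.1 ++ a) = c u a := by
    intro u hu a
    have h : ∃ v ∈ U, v.1 <+: u.1 ++ a := ⟨u, hu, List.prefix_append _ _⟩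
    have hv : h.choose = u := by
      rcases List.prefix_or_prefix_of_prefix h.choose_spec.2 (List.prefix_append u.1 a) with h' | h'
      · exact ha _ h.choose_spec.1 _ hu h'
      · exact (ha _ hu _ h.choose_spec.1 h').symm
    simp only [g, dif_pos h]
    rw [hv]
    simp
  have g_out : ∀ q, (¬ ∃ u ∈ U, u.1 <+: q) → g q = s q := fun q h => dif_neg h
  let t : ITerm ar X :=
    { toFun := g
      root_isSome := by
        by_cases h : ∃ u ∈ U, u.1 <+: []
        · obtain ⟨u, hu, h⟩ := h
          have := g_in u hu []
          rw [List.prefix_nil] at h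
          rw [h, List.append_nil] at this
          rw [this]
          exact (c u).root_isSome
        · rw [g_out _ h]
          exact s.root_isSome
      isSome_iff := fun q i => by
        by_cases h : ∃ u ∈ U, u.1 <+: q
        · obtain ⟨u, hu, a, rfl⟩ := h
          rw [List.append_assoc, g_in u hu, g_in u hu]
          exact (c u).isSome_iff a i
        · rw [g_out q h]
          by_cases h' : ∃ u ∈ U, u.1 <+: q ++ [i]
          · obtain ⟨u, hu, hu'⟩ := h'
            have hq : u.1 = q ++ [i] := by
              rcases List.prefix_concat_iff.1 hu' with h'' | h''
              · simpa using h''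
              · exact absurd ⟨u, hu, h''⟩ h
            have h1 := g_in u hu []
            rw [List.append_nil, hq] at h1
            rw [h1]
            have h2 := isSome_of_lhs_matches (hm u hu)
            rw [hq] at h2
            exact iff_of_true (c u).root_isSome ((s.isSome_iff q i).1 h2)
          · rw [g_out _ h']
            exact s.isSome_iff q i }
  refine ⟨t, ha, hm, fun q hq => g_out q fun ⟨u, hu, h⟩ => hq u hu h, fun u hu q f hq => ?_,
    fun u hu q₀ q x hq₀ hq w => ?_⟩
  · exact (g_in u hu q).trans (ITerm.subst_apply_fn _ _ hq)
  · have hs := isSome_of_lhs_matches (hm u hu)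
    refine (g_in u hu (q ++ w)).trans ?_
    rw [ITerm.subst_matchSubst_apply (hR _ u.2.2) (ITerm.matches_subterm hs (hm u hu)) _ hq hq₀,
      ITerm.subterm_apply hs]

theorem exists_contracts_singleton (hR : R.LeftLinear) (u : R.Redex)
    (hm : u.2.1.lhs.Matches s u.1) : ∃ t, R.Contracts {u} s t :=
  exists_contracts hR (by simp) (by simpa using hm)

theorem Contracts.exists_of_subset (hR : R.LeftLinear) (h : R.Contracts U s t)
    {A : Set R.Redex} (hA : A ⊆ U) : ∃ a, R.Contracts A s a :=
  exists_contracts hR (fun u hu v hv => h.antichain u (hA hu) v (hA hv))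
    fun u hu => h.lhs_matches u (hA hu)

theorem contracts_empty (R : ITRS ar X) (s : ITerm ar X) : R.Contracts ∅ s s where
  antichain := by simp
  lhs_matches := by simp
  outside := fun _ _ => rfl
  rhs_matches := by simp
  inside := by simp

/-- A set of redexes at disjoint positions can be contracted in two portions. -/
theorem Contracts.sdiff (h : R.Contracts U s t) {A : Set R.Redex} (hA : A ⊆ U) {a : ITerm ar X}
    (ha : R.Contracts A s a) : R.Contracts (U \ A) a t := by
  -- Disjointness leaves the whole subterm at every remaining redex untouched.
  have key : ∀ v ∈ U \ A, ∀ q, a (v.1 ++ q) = s (v.1 ++ q) := fun v hv q =>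
    ha.outside _ fun u hu hpre => hv.2 <| by
      rw [← h.eq_of_comparable (hA hu) hv.1
        (List.prefix_or_prefix_of_prefix hpre (List.prefix_append _ _))]
      exact hu
  refine ⟨fun u hu v hv => h.antichain u hu.1 v hv.1, fun u hu q f hq => ?_, fun q hq => ?_,
    fun u hu => h.rhs_matches u hu.1, fun u hu q₀ q x hq₀ hq w => ?_⟩
  · rw [key u hu]
    exact h.lhs_matches u hu.1 q f hq
  · by_cases hq' : ∃ u ∈ A, u.1 <+: q
    · obtain ⟨u, hu, c, rfl⟩ := hq'
      refine (h.rhs_matches u (hA hu)).apply_eq (ha.rhs_matches u hu) c fun q b x _ hx => ?_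
      obtain ⟨q₀, hq₀⟩ := u.2.1.exists_lhs_var hx
      rw [h.inside u (hA hu) q₀ q x hq₀ hx, ha.inside u hu q₀ q x hq₀ hx]
    · have hA' : ∀ u ∈ A, ¬ u.1 <+: q := fun u hu h' => hq' ⟨u, hu, h'⟩
      rw [ha.outside q hA']
      refine h.outside q fun u hu => ?_
      by_cases hu' : u ∈ A
      · exact hA' u hu'
      · exact hq u ⟨hu, hu'⟩
  · rw [key u hu]
    exact h.inside u hu.1 q₀ q x hq₀ hq w

theorem lhs_matches_of_subterm_eq {ρ : IRule ar X} {p : List ℕ} (hp : (s p).isSome)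
    {σ : X → ITerm ar X} (h : s.subterm p = ρ.lhs.subst σ) : ρ.lhs.Matches s p := fun q f hq => by
  rw [← ITerm.subterm_apply hp, h]
  exact ITerm.subst_apply_fn _ _ hq

theorem isRedexIn_iff (hR : R.LeftLinear) (u : R.Redex) :
    R.IsRedexIn s u ↔ u.2.1.lhs.Matches s u.1 := by
  constructor
  · rintro ⟨hp, σ, hσ⟩
    exact lhs_matches_of_subterm_eq hp hσ
  · intro h
    have hp := isSome_of_lhs_matches h
    exact ⟨hp, _, (ITerm.subst_matchSubst (hR _ u.2.2)
      (ITerm.matches_subterm hp h) ITerm.var).symm⟩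

theorem StepAt.contracts {p : List ℕ} (h : R.StepAt p s t) :
    ∃ ρ : R.rules, R.Contracts {(p, ρ)} s t := by
  obtain ⟨hp, ρ, hρ, σ, hσ, rfl⟩ := h
  refine ⟨⟨ρ, hρ⟩, by simp, ?_, ?_, ?_, ?_⟩
  · rintro _ rfl
    exact lhs_matches_of_subterm_eq hp hσ
  · intro q hq
    exact ITerm.replaceAt_apply_of_not_prefix (hq _ rfl)
  · rintro _ rfl q f hq
    exact (ITerm.replaceAt_apply_append hp q).trans (ITerm.subst_apply_fn _ _ hq)
  · rintro _ rfl q₀ q x hq₀ hq w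
    refine (ITerm.replaceAt_apply_append hp (q ++ w)).trans ?_
    rw [← ITerm.subterm_apply hp, hσ]
    exact (ITerm.subst_apply_var _ _ hq w).trans (ITerm.subst_apply_var _ _ hq₀ w).symm

theorem Contracts.stepAt (hR : R.LeftLinear) {u : R.Redex} (h : R.Contracts {u} s t) :
    R.StepAt u.1 s t := by
  have hm := h.lhs_matches u rfl
  have hp := isSome_of_lhs_matches hm
  have hm' := ITerm.matches_subterm hp hm
  refine ⟨hp, u.2.1, u.2.2, u.2.1.lhs.matchSubst (s.subterm u.1) ITerm.var,
    (ITerm.subst_matchSubst (hR _ u.2.2) hm' _).symm, ?_⟩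
  refine ITerm.ext_apply fun q => ?_
  by_cases hq : u.1 <+: q
  · obtain ⟨a, rfl⟩ := hq
    rw [ITerm.replaceAt_apply_append hp]
    refine (h.rhs_matches u rfl).apply_eq (p' := []) (ITerm.matches_subst _ _) a
      fun q b x _ hx => ?_
    obtain ⟨q₀, hq₀⟩ := u.2.1.exists_lhs_var hx
    rw [h.inside u rfl q₀ q x hq₀ hx, List.nil_append,
      ITerm.subst_matchSubst_apply (hR _ u.2.2) hm' _ hx hq₀, ITerm.subterm_apply hp]
  · rw [ITerm.replaceAt_apply_of_not_prefix hq]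
    exact h.outside q (by simpa using hq)

end ITRS

/-! ### Fresh variables and terms cut off below a pattern -/

namespace ITerm

theorem finite_vars {t : ITerm ar X} (h : t.pos.Finite) : t.vars.Finite := by
  have h1 : ((fun p => t p) '' t.pos).Finite := h.image _
  have h2 : (fun x : X => (some (Sum.inr x) : Option (F ⊕ X))) '' t.vars ⊆
      (fun p => t p) '' t.pos := by
    rintro _ ⟨x, ⟨p, hp⟩, rfl⟩
    exact ⟨p, by simp [pos, hp], hp⟩
  exact (h1.subset h2).of_finite_image fun x _ y _ hxy => by simpa using hxy

theorem exists_fresh [Countable X] [Infinite X] {S : Set X} (hS : S.Finite) :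
    ∃ z : List ℕ → X, Function.Injective z ∧ ∀ q, z q ∉ S := by
  have : Infinite (Sᶜ : Set X) := hS.infinite_compl.to_subtype
  let e := Infinite.natEmbedding (Sᶜ : Set X)
  refine ⟨fun q => (e (Encodable.encode q)).1, fun q r h => ?_,
    fun q => (e (Encodable.encode q)).2⟩
  exact Encodable.encode_injective (e.injective (Subtype.ext h))

open scoped Classical in
/-- The term `t`, cut off outside the set `P` of positions of function symbols; the variable `z q`
is put at the position `q` of a cut. -/
noncomputable def cut (t : ITerm ar X) (P : Set (List ℕ)) (z : List ℕ → X)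
    (_hP : ∀ p ∈ P, ∃ f, t p = some (Sum.inl f)) : ITerm ar X where
  toFun q :=
    if (∀ r i, r ++ [i] <+: q → r ∈ P) ∧ (t q).isSome then
      if q ∈ P then t q else some (Sum.inr (z q))
    else none
  root_isSome := by
    have h : ∀ r i, r ++ [i] <+: ([] : List ℕ) → r ∈ P := by simp
    rw [if_pos ⟨h, t.root_isSome⟩]
    split
    · exact t.root_isSome
    · rfl
  isSome_iff q i := by
    have h1 : (∀ r j, r ++ [j] <+: q ++ [i] → r ∈ P) ↔
        (∀ r j, r ++ [j] <+: q → r ∈ P) ∧ q ∈ P := by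
      constructor
      · intro h
        exact ⟨fun r j hr => h r j (hr.trans (List.prefix_append _ _)),
          h q i (List.prefix_refl _)⟩
      · rintro ⟨h, hq⟩ r j hr
        rcases List.prefix_concat_iff.1 hr with h' | h'
        · rw [List.append_inj_left' h' rfl]
          exact hq
        · exact h r j h'
    have h2 : ∀ q, (if (∀ r j, r ++ [j] <+: q → r ∈ P) ∧ (t q).isSome then
        if q ∈ P then t q else some (Sum.inr (z q)) else none).isSome ↔
        (∀ r j, r ++ [j] <+: q → r ∈ P) ∧ (t q).isSome := by
      intro q
      by_cases h : (∀ r j, r ++ [j] <+: q → r ∈ P) ∧ (t q).isSome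
      · rw [if_pos h]
        refine iff_of_true ?_ h
        split
        · exact h.2
        · rfl
      · rw [if_neg h]
        simpa using h
    rw [h2, h1, t.isSome_iff]
    constructor
    · rintro ⟨⟨hw, hq⟩, f, hf, hi⟩
      exact ⟨f, by rw [if_pos ⟨hw, by simp [hf]⟩, if_pos hq, hf], hi⟩
    · rintro ⟨f, hf, hi⟩
      split at hf
      · split at hf
        · rename_i hw hq
          exact ⟨⟨hw.1, hq⟩, f, hf, hi⟩
        · simp at hf
      · simp at hf

section Cut

variable {t : ITerm ar X} {P : Set (List ℕ)} {z : List ℕ → X}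
  {hP : ∀ p ∈ P, ∃ f, t p = some (Sum.inl f)}

theorem cut_eq_fn {q : List ℕ} {f : F} (h : t.cut P z hP q = some (Sum.inl f)) :
    q ∈ P ∧ t q = some (Sum.inl f) := by
  simp only [cut] at h
  split at h
  · split at h
    · exact ⟨‹_›, h⟩
    · simp at h
  · simp at h

theorem cut_eq_var {q : List ℕ} {x : X} (h : t.cut P z hP q = some (Sum.inr x)) : x = z q := by
  simp only [cut] at h
  split at h
  · split at h
    · obtain ⟨f, hf⟩ := hP q ‹_›
      simp [hf] at h
    · simpa using h.symm
  · simp at h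

theorem cut_linear (hz : Function.Injective z) : (t.cut P z hP).Linear := fun _ _ _ hp hq =>
  hz ((cut_eq_var hp).symm.trans (cut_eq_var hq))

theorem Matches.cut {r : ITerm ar X} (h : r.Matches t [])
    (hr : ∀ q f, r q = some (Sum.inl f) → q ∈ P) : r.Matches (t.cut P z hP) [] := by
  intro q f hq
  have hw : ∀ c i, c ++ [i] <+: q → c ∈ P := by
    rintro c i ⟨d, rfl⟩
    rw [List.append_assoc] at hq
    obtain ⟨g, hg⟩ := r.fn_of_prefix_fn hq
    exact hr c g hg
  have ht : t q = some (Sum.inl f) := h q f hq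
  have hs : (t.toFun q).isSome := by simp [ht]
  show t.cut P z hP q = _
  simp only [ITerm.cut]
  rw [if_pos ⟨hw, hs⟩, if_pos (hr q f hq), ht]

/-- With `cut_linear`, this makes the cut most general: every term that agrees with `t` on `P` is an
instance of it. -/
theorem cut_matches {t' : ITerm ar X} (h : ∀ q ∈ P, t' q = t q) :
    (t.cut P z hP).Matches t' [] := fun q f hq => by
  obtain ⟨hq', hf⟩ := cut_eq_fn hq
  rw [List.nil_append, h q hq', hf]

end Cut

end ITerm

/-! ### Overlapping redexes and critical pairs -/

namespace ITRS

open ITerm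

/-- Overlapping patterns in a term give rise to a critical pair. -/
theorem exists_criticalPair [Countable X] [Infinite X] {ρ₁ ρ₂ : IRule ar X} (h₁ : ρ₁.lhs.Linear)
    (h₂ : ρ₂.lhs.Linear) {p : List ℕ} (hp : ∃ f, ρ₁.lhs p = some (Sum.inl f)) {S : ITerm ar X}
    (hS₁ : ρ₁.lhs.Matches S []) (hS₂ : ρ₂.lhs.Matches S p) :
    ∃ σ τ δ : X → ITerm ar X,
      IsCriticalPair ρ₁ ρ₂ ((ρ₁.lhs.subst σ).replaceAt p (ρ₂.rhs.subst τ)) (ρ₁.rhs.subst σ) ∧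
      (∀ x q, ρ₁.lhs q = some (Sum.inr x) → (σ x).subst δ = S.subterm q) ∧
      (∀ x q, ρ₂.lhs q = some (Sum.inr x) → (τ x).subst δ = S.subterm (p ++ q)) := by
  obtain ⟨f₀, hf₀⟩ := hp
  obtain ⟨z, hz, hzf⟩ := exists_fresh (finite_vars ρ₁.lhs_finite)
  have hp1 : (ρ₁.lhs p).isSome := by simp [hf₀]
  have hpS : (S p).isSome := isSome_of_lhs_matches hS₂
  set A := ρ₁.lhs.subterm p with hA
  set B := ρ₂.lhs with hB
  set T := S.subterm p with hT
  have hAl : A.Linear := by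
    intro q q' x hq hq'
    rw [hA, subterm_apply hp1] at hq hq'
    simpa using h₁ _ _ _ hq hq'
  have hAT : A.Matches T [] := by
    intro q f hq
    rw [hA, subterm_apply hp1] at hq
    rw [List.nil_append, hT, subterm_apply hpS]
    exact hS₁ _ _ hq
  have hBT : B.Matches T [] := matches_subterm hpS hS₂
  -- The two patterns laid over each other. Cutting `T` outside them, with a fresh variable at each
  -- cut, gives the most general common instance, since both patterns are linear.
  let P : Set (List ℕ) :=
    {q | (∃ f, A q = some (Sum.inl f)) ∨ ∃ f, B q = some (Sum.inl f)}
  have hP : ∀ q ∈ P, ∃ f, T q = some (Sum.inl f) := by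
    rintro q (⟨f, hf⟩ | ⟨f, hf⟩)
    · exact ⟨f, hAT q f hf⟩
    · exact ⟨f, hBT q f hf⟩
  set m := T.cut P z hP with hm
  have hml : m.Linear := cut_linear hz
  have hAm : A.Matches m [] := hAT.cut fun q f h => Or.inl ⟨f, h⟩
  have hBm : B.Matches m [] := hBT.cut fun q f h => Or.inr ⟨f, h⟩
  have hAσ := subst_matchSubst hAl hAm var
  have hBτ := subst_matchSubst h₂ hBm var
  -- `σ` fixes the variables of the outer left-hand side that are outside `A`, so `δ` itself has to
  -- send them to subterms of `S`. The choice is free, because these variables do not occur in `m`.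
  let d := ρ₁.lhs.matchSubst S var
  have hmδ : m.subst (m.matchSubst T d) = T :=
    subst_matchSubst hml (cut_matches fun _ _ => rfl) d
  have hsub : ∀ q, (m q).isSome → (m.subterm q).subst (m.matchSubst T d) = S.subterm (p ++ q) := by
    intro q hq
    have hTq : (T q).isSome := by
      have := (cut_matches (t := T) (P := P) (z := z) (hP := hP) (t' := T)
        fun _ _ => rfl).isSome (p := []) T.root_isSome hq
      simpa using this
    refine ext_apply fun a => ?_
    rw [hT, subterm_apply hpS] at hTq
    rw [subterm_subst hq, hmδ, subterm_apply hTq, hT, subterm_apply hpS, List.append_assoc]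
  refine ⟨A.matchSubst m var, B.matchSubst m var, m.matchSubst T d,
    ⟨p, _, _, ⟨f₀, hf₀⟩, hAσ.trans hBτ.symm, ?_, ?_, ?_, rfl, rfl⟩, ?_, ?_⟩
  · intro σ' τ' h
    refine ⟨m.matchSubst (A.subst σ') var, ?_⟩
    -- Any common instance carries both patterns, hence has the symbols of `T` on `P`, and so is an
    -- instance of the linear term `m`.
    have hmm : m.Matches (A.subst σ') [] := cut_matches <| by
      rintro q (⟨f, hf⟩ | ⟨f, hf⟩)
      · rw [subst_apply_fn A σ' hf]
        exact (hAT q f hf).symm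
      · rw [h, subst_apply_fn ρ₂.lhs τ' hf]
        exact (hBT q f hf).symm
    rw [hAσ, subst_matchSubst hml hmm]
  · ext x
    constructor
    · intro hx
      by_contra h
      exact hx (matchSubst_of_notMem m var h)
    · rintro ⟨q, hq⟩ h
      rw [matchSubst_of_var hAl m var hq] at h
      have hmq : (m q).isSome := by
        simpa using hAm.isSome m.root_isSome (q := q) (by rw [hq]; rfl)
      -- If `σ x` were `x`, then `x` would be one of the fresh variables at the cuts.
      have h' : m q = some (Sum.inr x) := by
        have := subterm_apply hmq []
        rw [h, List.append_nil] at this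
        exact this.symm
      have hx : x = z q := cut_eq_var h'
      apply hzf q
      rw [← hx]
      exact ⟨p ++ q, by rwa [subterm_apply hp1] at hq⟩
  · rintro x ⟨q, hq⟩ q' _ hq'
    rw [hAσ] at hq
    apply hzf q
    rw [← cut_eq_var hq]
    exact ⟨q', hq'⟩
  · intro x q hq
    by_cases hx : x ∈ A.vars
    · obtain ⟨q', hq'⟩ := hx
      have hq'' := hq'
      rw [hA, subterm_apply hp1] at hq''
      obtain rfl := h₁ _ _ _ hq hq''
      rw [matchSubst_of_var hAl m var hq']
      apply hsub
      simpa using hAm.isSome m.root_isSome (q := q') (by simp [hq'])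
    · have hxm : x ∉ m.vars := by
        rintro ⟨q', hq'⟩
        exact hzf q' (cut_eq_var hq' ▸ ⟨q, hq⟩)
      rw [matchSubst_of_notMem m var hx, var_subst, matchSubst_of_notMem T d hxm]
      exact matchSubst_of_var h₁ S var hq
  · intro x q hq
    rw [matchSubst_of_var h₂ m var hq]
    apply hsub
    simpa using hBm.isSome m.root_isSome (q := q) (by rw [hq]; rfl)

variable {R : ITRS ar X} {s : ITerm ar X}

/-- In a weakly orthogonal system, overlapping redexes have the same effect. -/
theorem Contracts.eq_of_overlap [Countable X] [Infinite X] (hR : R.WeaklyOrthogonal)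
    {ρ₁ ρ₂ : R.rules} {p₁ p : List ℕ} {t₁ t₂ : ITerm ar X}
    (hp : ∃ f, ρ₁.1.lhs p = some (Sum.inl f)) (h₁ : R.Contracts {(p₁, ρ₁)} s t₁)
    (h₂ : R.Contracts {(p₁ ++ p, ρ₂)} s t₂) : t₁ = t₂ := by
  have hm₁ : ρ₁.1.lhs.Matches s p₁ := h₁.lhs_matches _ rfl
  have hm₂ : ρ₂.1.lhs.Matches s (p₁ ++ p) := h₂.lhs_matches _ rfl
  have hs := isSome_of_lhs_matches hm₁
  have hsp := isSome_of_lhs_matches hm₂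
  have hm₁' : ρ₁.1.lhs.Matches (s.subterm p₁) [] := matches_subterm hs hm₁
  have hm₂' : ρ₂.1.lhs.Matches (s.subterm p₁) p := fun q f hq => by
    rw [subterm_apply hs, ← List.append_assoc]
    exact hm₂ q f hq
  obtain ⟨σ, τ, δ, hcp, hσ, hτ⟩ := exists_criticalPair (hR.1 _ ρ₁.2) (hR.1 _ ρ₂.2) hp hm₁' hm₂'
  have heq := hR.2 _ ρ₁.2 _ ρ₂.2 _ _ hcp
  have hsome : ∀ q x, ρ₁.1.lhs q = some (Sum.inr x) → (s (p₁ ++ q)).isSome := fun q x hq =>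
    hm₁.isSome hs (by simp [hq])
  have hsub : ∀ q x b, ρ₁.1.lhs q = some (Sum.inr x) → (σ x).subst δ b = s (p₁ ++ (q ++ b)) := by
    intro q x b hq
    rw [hσ x q hq, subterm_apply, subterm_apply hs]
    rw [subterm_apply hs]
    exact hsome q x hq
  have hsub₂ : ∀ q x b, ρ₂.1.lhs q = some (Sum.inr x) →
      (τ x).subst δ b = s (p₁ ++ p ++ (q ++ b)) := by
    intro q x b hq
    have hq' : (s (p₁ ++ p ++ q)).isSome := hm₂.isSome hsp (by simp [hq])
    rw [hτ x q hq, subterm_apply, subterm_apply hs]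
    · simp
    · rw [subterm_apply hs]
      simpa using hq'
  have hsubst : ∀ (r : ITerm ar X) (θ : X → ITerm ar X), r.Matches ((r.subst θ).subst δ) [] :=
    fun r θ q f hq => subst_apply_fn _ δ (subst_apply_fn r θ hq)
  have hsubst_var : ∀ (r : ITerm ar X) (θ : X → ITerm ar X) q x b, r q = some (Sum.inr x) →
      (r.subst θ).subst δ (q ++ b) = (θ x).subst δ b := by
    intro r θ q x b hq
    have hq' : (r.subst θ q).isSome := by
      have := subst_apply_var r θ hq []
      rw [List.append_nil] at this
      rw [this]
      exact (θ x).root_isSome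
    rw [← subterm_subst hq']
    congr 2
    refine ext_apply fun a => ?_
    rw [subterm_apply hq', subst_apply_var r θ hq]
  -- Below `p₁` the two contracta are the `δ`-instances of the two components of the critical pair,
  -- which are equal.
  have h1 : ∀ a, t₁ (p₁ ++ a) = (ρ₁.1.rhs.subst σ).subst δ a := by
    intro a
    refine (h₁.rhs_matches _ rfl).apply_eq (hsubst _ _) a fun q b x _ hx => ?_
    obtain ⟨q₀, hq₀⟩ := ρ₁.1.exists_lhs_var hx
    rw [h₁.inside _ rfl q₀ q x hq₀ hx, List.nil_append, hsubst_var _ _ _ _ _ hx,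
      hsub q₀ x b hq₀]
  have hl : ∀ a, (ρ₁.1.lhs.subst σ).subst δ a = s (p₁ ++ a) := by
    intro a
    refine (hsubst _ _).apply_eq (p := []) hm₁ a fun q b x _ hx => ?_
    rw [List.nil_append, hsubst_var _ _ _ _ _ hx, hsub q x b hx]
  have hlp : (ρ₁.1.lhs.subst σ p).isSome := by
    obtain ⟨f, hf⟩ := hp
    simp [subst_apply_fn _ σ hf]
  have h2 : ∀ a, t₂ (p₁ ++ a) =
      ((ρ₁.1.lhs.subst σ).replaceAt p (ρ₂.1.rhs.subst τ)).subst δ a := by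
    intro a
    by_cases ha : p <+: a
    · obtain ⟨c, rfl⟩ := ha
      have hr : (((ρ₁.1.lhs.subst σ).replaceAt p (ρ₂.1.rhs.subst τ)) p).isSome := by
        have := replaceAt_apply_append (u := ρ₂.1.rhs.subst τ) hlp []
        rw [List.append_nil] at this
        rw [this]
        exact (ρ₂.1.rhs.subst τ).root_isSome
      rw [← subterm_subst hr, ← List.append_assoc]
      have : ((ρ₁.1.lhs.subst σ).replaceAt p (ρ₂.1.rhs.subst τ)).subterm p =
          ρ₂.1.rhs.subst τ :=
        ext_apply fun a => by rw [subterm_apply hr, replaceAt_apply_append hlp]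
      rw [this]
      refine (h₂.rhs_matches _ rfl).apply_eq (hsubst _ _) c fun q b x _ hx => ?_
      obtain ⟨q₀, hq₀⟩ := ρ₂.1.exists_lhs_var hx
      rw [h₂.inside _ rfl q₀ q x hq₀ hx, List.nil_append, hsubst_var _ _ _ _ _ hx,
        hsub₂ q₀ x b hq₀]
    · rw [h₂.outside _ (by simpa using ha), ← hl]
      refine subst_apply_congr δ fun c hc => (replaceAt_apply_of_not_prefix ?_).symm
      exact fun h => ha (h.trans hc)
  refine ext_apply fun q => ?_
  by_cases hq : p₁ <+: q
  · obtain ⟨a, rfl⟩ := hq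
    rw [h1, h2, heq]
  · rw [h₁.outside q (by simpa using hq), h₂.outside q]
    rintro _ rfl h
    exact hq ((List.prefix_append _ _).trans h)

end ITRS

/-! ### Projection of a parallel step over a single step -/

namespace ITRS

open ITerm

variable {R : ITRS ar X} {s t : ITerm ar X} {U : Set R.Redex}

/-- The residuals of the redexes in `U` after contraction of the redex `v`. -/
def residuals (U : Set R.Redex) (v : R.Redex) : Set R.Redex :=
  {w | (w ∈ U ∧ ¬ v.1 <+: w.1) ∨ ∃ q q' r x, v.2.1.lhs q = some (Sum.inr x) ∧
    v.2.1.rhs q' = some (Sum.inr x) ∧ (v.1 ++ (q ++ r), w.2) ∈ U ∧ w.1 = v.1 ++ (q' ++ r)}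

/-- The residuals of the redex `v`, which is at position `r` below the variable `x` of the redex `u`,
after contraction of `u`. -/
def copies (u v : R.Redex) (x : X) (r : List ℕ) : Set R.Redex :=
  {w | w.2 = v.2 ∧ ∃ q, u.2.1.rhs q = some (Sum.inr x) ∧ w.1 = u.1 ++ (q ++ r)}

theorem prefix_of_append_prefix {p a b : List ℕ} (h : p ++ a <+: p ++ b) : a <+: b :=
  (List.prefix_append_right_inj p).1 h

/-- A single step inside a redex of a parallel step. -/
theorem Contracts.project_inside (hR : R.LeftLinear) {s₁ : ITerm ar X}
    (h : R.Contracts U s t) {u v : R.Redex} (hv : R.Contracts {v} s s₁) (hu : u ∈ U)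
    {q₀ r : List ℕ} {x : X} (hq₀ : u.2.1.lhs q₀ = some (Sum.inr x))
    (huv : v.1 = u.1 ++ (q₀ ++ r)) :
    ∃ t', R.Contracts U s₁ t' ∧ R.Contracts (copies u v x r) t t' := by
  have hout : ∀ a, ¬ v.1 <+: a → s₁ a = s a := fun a ha => hv.outside a (by simpa using ha)
  have hother : ∀ u' ∈ U, u' ≠ u → ∀ b, s₁ (u'.1 ++ b) = s (u'.1 ++ b) := by
    intro u' hu' hne b
    refine hout _ fun hpre => hne ?_
    rw [huv] at hpre
    exact h.eq_of_comparable hu' hu (prefix_comparable hpre).symm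
  -- A pattern position below `v` would be below the variable position `q₀`, but variables are
  -- leaves.
  have hpat : ∀ a f, u.2.1.lhs a = some (Sum.inl f) → s₁ (u.1 ++ a) = s (u.1 ++ a) := by
    intro a f ha
    refine hout _ fun hpre => ?_
    rw [huv] at hpre
    obtain ⟨c, hc⟩ := prefix_of_append_prefix hpre
    rw [List.append_assoc] at hc
    have := u.2.1.lhs.eq_nil_of_var hq₀ (q := r ++ c) (by rw [hc]; simp [ha])
    rw [this, List.append_nil] at hc
    rw [hc, ha] at hq₀
    simp at hq₀
  have hm : ∀ w ∈ U, w.2.1.lhs.Matches s₁ w.1 := by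
    intro w hw a f ha
    by_cases hwu : w = u
    · subst hwu
      rw [hpat a f ha]
      exact h.lhs_matches _ hw a f ha
    · rw [hother w hw hwu]
      exact h.lhs_matches _ hw a f ha
  obtain ⟨t', ht'⟩ := exists_contracts hR h.antichain hm
  have hin : ∀ q a, u.2.1.rhs q = some (Sum.inr x) → t (u.1 ++ (q ++ (r ++ a))) = s (v.1 ++ a) := by
    intro q a hq
    rw [h.inside u hu q₀ q x hq₀ hq, huv]
    simp
  have hin' : ∀ q a, u.2.1.rhs q = some (Sum.inr x) →
      t' (u.1 ++ (q ++ (r ++ a))) = s₁ (v.1 ++ a) := by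
    intro q a hq
    rw [ht'.inside u hu q₀ q x hq₀ hq, huv]
    simp
  refine ⟨t', ht', ?_, ?_, ?_, ?_, ?_⟩
  · rintro ⟨w, _⟩ ⟨rfl, q, hq, rfl⟩ ⟨w', _⟩ ⟨rfl, q', hq', rfl⟩ hpre
    obtain rfl := u.2.1.rhs.var_prefix_unique hq hq' (prefix_of_append_prefix hpre)
    rfl
  · rintro ⟨w, _⟩ ⟨rfl, q, hq, rfl⟩ a f ha
    simp only [List.append_assoc]
    rw [hin q a hq]
    exact hv.lhs_matches v rfl a f ha
  · intro a ha
    by_cases hpre : ∃ w ∈ U, w.1 <+: a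
    · obtain ⟨w, hw, c, rfl⟩ := hpre
      refine (ht'.rhs_matches w hw).apply_eq (h.rhs_matches w hw) c fun q b y hc hy => ?_
      obtain ⟨q₁, hq₁⟩ := w.2.1.exists_lhs_var hy
      rw [ht'.inside w hw q₁ q y hq₁ hy, h.inside w hw q₁ q y hq₁ hy]
      by_cases hwu : w = u
      · subst hwu
        refine hout _ fun hpre => ?_
        rw [huv] at hpre
        have hpre' := prefix_of_append_prefix hpre
        obtain rfl := w.2.1.lhs.var_prefix_unique hq₀ hq₁ hpre'
        obtain rfl : x = y := by simpa [hq₀] using hq₁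
        refine ha (w.1 ++ (q ++ r), v.2) ⟨rfl, q, hy, rfl⟩ ?_
        rw [hc]
        have := prefix_of_append_prefix hpre'
        simpa [List.prefix_append_right_inj] using this
      · exact hother w hw hwu _
    · have hno : ∀ w ∈ U, ¬ w.1 <+: a := fun w hw h' => hpre ⟨w, hw, h'⟩
      rw [ht'.outside a hno, h.outside a hno]
      refine hout a fun h' => hno u hu ?_
      rw [huv] at h'
      exact (List.prefix_append _ _).trans h'
  · rintro ⟨w, _⟩ ⟨rfl, q, hq, rfl⟩ a f ha
    simp only [List.append_assoc]
    rw [hin' q a hq]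
    exact hv.rhs_matches v rfl a f ha
  · rintro ⟨w, _⟩ ⟨rfl, q, hq, rfl⟩ q₁ q₂ y hq₁ hq₂ a
    simp only [List.append_assoc]
    rw [hin' q _ hq, hin q _ hq]
    exact hv.inside v rfl q₁ q₂ y hq₁ hq₂ a

/-- A single step that is not inside a redex of a parallel step, and does not overlap with them. -/
theorem Contracts.project_outside (hR : R.LeftLinear) {s₁ : ITerm ar X}
    (h : R.Contracts U s t) {v : R.Redex} (hv : R.Contracts {v} s s₁)
    (hU : ∀ u ∈ U, ¬ u.1 <+: v.1)
    (hU' : ∀ u ∈ U, v.1 <+: u.1 → ∃ q r x, v.2.1.lhs q = some (Sum.inr x) ∧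
      u.1 = v.1 ++ (q ++ r)) :
    ∃ t', R.Contracts (residuals U v) s₁ t' ∧ R.Contracts {v} t t' := by
  have hlin := hR _ v.2.2
  have hout : ∀ a, ¬ v.1 <+: a → s₁ a = s a := fun a ha => hv.outside a (by simpa using ha)
  have hcmp : ∀ u ∈ U, ∀ b c, u.1 ++ b <+: v.1 ++ c → v.1 <+: u.1 := fun u hu b c h' =>
    (prefix_comparable h').resolve_left (hU u hu)
  have hcmp' : ∀ u ∈ U, ∀ b, v.1 <+: u.1 ++ b → v.1 <+: u.1 := fun u hu b h' => by
    rcases List.prefix_or_prefix_of_prefix h' (List.prefix_append u.1 b) with h'' | h''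
    · exact h''
    · exact absurd h'' (hU u hu)
  have hm : v.2.1.lhs.Matches t v.1 := by
    intro a f ha
    rw [h.outside, hv.lhs_matches v rfl a f ha]
    intro u hu hpre
    obtain ⟨q, r, x, hq, hu1⟩ := hU' u hu (hcmp u hu [] a (by simpa using hpre))
    rw [hu1] at hpre
    obtain ⟨c, hc⟩ := prefix_of_append_prefix hpre
    rw [List.append_assoc] at hc
    have := v.2.1.lhs.eq_nil_of_var hq (q := r ++ c) (by rw [hc]; simp [ha])
    rw [this, List.append_nil] at hc
    rw [hc, ha] at hq
    simp at hq
  obtain ⟨t', ht'⟩ := exists_contracts_singleton hR v hm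
  have hout' : ∀ a, ¬ v.1 <+: a → t' a = t a := fun a ha => ht'.outside a (by simpa using ha)
  refine ⟨t', ⟨?_, ?_, ?_, ?_, ?_⟩, ht'⟩
  · rintro ⟨w, ρ⟩ (⟨hw, hvw⟩ | ⟨q, q', r, x, hq, hq', hw, rfl⟩) ⟨w', ρ'⟩
      (⟨hw', hvw'⟩ | ⟨q₁, q₁', r', x', hq₁, hq₁', hw', rfl⟩) hpre
    · exact h.antichain _ hw _ hw' hpre
    · exact absurd (hcmp _ hw [] _ (by simpa using hpre)) hvw
    · exact absurd ((List.prefix_append _ _).trans hpre) hvw'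
    · have hpre' := prefix_of_append_prefix hpre
      obtain rfl := v.2.1.rhs.var_prefix_unique hq' hq₁' hpre'
      obtain rfl : x = x' := by simpa [hq'] using hq₁'
      obtain rfl := hlin _ _ _ hq hq₁
      have hr := prefix_of_append_prefix hpre'
      have := h.antichain _ hw _ hw' (by simpa [List.prefix_append_right_inj] using hr)
      simpa using this
  · rintro ⟨w, ρ⟩ (⟨hw, hvw⟩ | ⟨q, q', r, x, hq, hq', hw, rfl⟩) a f ha
    · rw [hout _ fun h' => hvw (hcmp' _ hw a h')]
      exact h.lhs_matches _ hw a f ha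
    · simp only [List.append_assoc]
      rw [hv.inside v rfl q q' x hq hq']
      simpa using h.lhs_matches _ hw a f ha
  · intro a ha
    by_cases hva : v.1 <+: a
    · obtain ⟨c, rfl⟩ := hva
      refine (ht'.rhs_matches v rfl).apply_eq (hv.rhs_matches v rfl) c fun q b x hc hx => ?_
      obtain ⟨q₀, hq₀⟩ := v.2.1.exists_lhs_var hx
      rw [ht'.inside v rfl q₀ q x hq₀ hx, hv.inside v rfl q₀ q x hq₀ hx]
      refine h.outside _ fun u hu hpre => ?_
      obtain ⟨q₁, r, y, hq₁, hu1⟩ := hU' u hu (hcmp u hu [] _ (by simpa using hpre))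
      rw [hu1] at hpre
      have hpre' := prefix_of_append_prefix hpre
      obtain rfl := v.2.1.lhs.var_prefix_unique hq₁ hq₀ hpre'
      obtain rfl : y = x := by simpa [hq₁] using hq₀
      refine ha (v.1 ++ (q ++ r), u.2)
        (Or.inr ⟨q₁, q, r, y, hq₁, hx, by rw [← hu1]; exact hu, rfl⟩) ?_
      rw [hc]
      have := prefix_of_append_prefix hpre'
      simpa [List.prefix_append_right_inj] using this
    · rw [hout _ hva, hout' _ hva]
      refine h.outside _ fun u hu hpre => ?_
      exact ha u (Or.inl ⟨hu, fun h' => hva (h'.trans hpre)⟩) hpre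
  · rintro ⟨w, ρ⟩ (⟨hw, hvw⟩ | ⟨q, q', r, x, hq, hq', hw, rfl⟩) a f ha
    · rw [hout' _ fun h' => hvw (hcmp' _ hw a h')]
      exact h.rhs_matches _ hw a f ha
    · simp only [List.append_assoc]
      rw [ht'.inside v rfl q q' x hq hq']
      simpa using h.rhs_matches _ hw a f ha
  · rintro ⟨w, ρ⟩ (⟨hw, hvw⟩ | ⟨q, q', r, x, hq, hq', hw, rfl⟩) q₁ q₂ y hq₁ hq₂ a
    · rw [hout _ fun h' => hvw (hcmp' _ hw _ h'), hout' _ fun h' => hvw (hcmp' _ hw _ h')]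
      exact h.inside _ hw q₁ q₂ y hq₁ hq₂ a
    · simp only [List.append_assoc]
      rw [ht'.inside v rfl q q' x hq hq', hv.inside v rfl q q' x hq hq']
      simpa using h.inside _ hw q₁ q₂ y hq₁ hq₂ a

/-- Projecting a parallel step over a single step: the redexes overlap, or the step is inside a redex
of the parallel step, or not. -/
theorem Contracts.project [Countable X] [Infinite X] (hR : R.WeaklyOrthogonal) {s₁ : ITerm ar X}
    (h : R.Contracts U s t) {v : R.Redex} (hv : R.Contracts {v} s s₁) :
    (∃ u ∈ U, ((∃ p f, v.1 = u.1 ++ p ∧ u.2.1.lhs p = some (Sum.inl f)) ∨ v.1 <+: u.1) ∧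
      R.Contracts (U \ {u}) s₁ t) ∨
    (∃ u ∈ U, ∃ q₀ r x, u.2.1.lhs q₀ = some (Sum.inr x) ∧ v.1 = u.1 ++ (q₀ ++ r) ∧
      ∃ t', R.Contracts U s₁ t' ∧ R.Contracts (copies u v x r) t t') ∨
    ∃ t', R.Contracts (residuals U v) s₁ t' ∧ R.Contracts {v} t t' := by
  by_cases h1 : ∃ u ∈ U, ∃ p f, v.1 = u.1 ++ p ∧ u.2.1.lhs p = some (Sum.inl f)
  · obtain ⟨u, hu, p, f, hp, hf⟩ := h1
    obtain ⟨a, ha⟩ := h.exists_of_subset hR.1 (Set.singleton_subset_iff.2 hu)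
    have hv' : R.Contracts {(u.1 ++ p, v.2)} s s₁ := by rw [← hp]; exact hv
    -- Contracting `u` alone also gives `s₁`, so `v` has done the work of `u` and only the other
    -- redexes remain.
    obtain rfl := ha.eq_of_overlap hR ⟨f, hf⟩ hv'
    exact Or.inl ⟨u, hu, Or.inl ⟨p, f, hp, hf⟩, h.sdiff (Set.singleton_subset_iff.2 hu) ha⟩
  by_cases h2 : ∃ u ∈ U, ∃ p f, u.1 = v.1 ++ p ∧ v.2.1.lhs p = some (Sum.inl f)
  · obtain ⟨u, hu, p, f, hp, hf⟩ := h2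
    obtain ⟨a, ha⟩ := h.exists_of_subset hR.1 (Set.singleton_subset_iff.2 hu)
    have ha' : R.Contracts {(v.1 ++ p, u.2)} s a := by rw [← hp]; exact ha
    obtain rfl := hv.eq_of_overlap hR ⟨f, hf⟩ ha'
    exact Or.inl ⟨u, hu, Or.inr ⟨p, hp.symm⟩, h.sdiff (Set.singleton_subset_iff.2 hu) ha⟩
  refine Or.inr ?_
  by_cases h3 : ∃ u ∈ U, u.1 <+: v.1
  · obtain ⟨u, hu, c, hc⟩ := h3
    rcases u.2.1.lhs.walk_cases c with ⟨f, hf⟩ | ⟨q, b, x, rfl, hx⟩ | ⟨c, i, d, f, rfl, hf, hi⟩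
    · exact absurd ⟨u, hu, c, f, hc.symm, hf⟩ h1
    · exact Or.inl ⟨u, hu, q, b, x, hx, hc.symm, h.project_inside hR.1 hv hu hx hc.symm⟩
    · have h4 := isSome_of_lhs_matches (hv.lhs_matches v rfl)
      rw [← hc, (h.lhs_matches u hu).eq_none hf hi] at h4
      simp at h4
  · refine Or.inr (h.project_outside hR.1 hv (fun u hu h' => h3 ⟨u, hu, h'⟩) ?_)
    rintro u hu ⟨c, hc⟩
    rcases v.2.1.lhs.walk_cases c with ⟨f, hf⟩ | ⟨q, b, x, rfl, hx⟩ | ⟨c, i, d, f, rfl, hf, hi⟩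
    · exact absurd ⟨u, hu, c, f, hc.symm, hf⟩ h2
    · exact ⟨q, b, x, hx, hc.symm⟩
    · have h4 := isSome_of_lhs_matches (h.lhs_matches u hu)
      rw [← hc, (hv.lhs_matches v rfl).eq_none hf hi] at h4
      simp at h4

end ITRS

/-! ### Strongly convergent reduction as an inductive relation -/

namespace ITRS

open ITerm

/-- `R.FinSteps d k s t`: the term `s` rewrites to `t` in `k` steps, all of depth at least `d`. -/
inductive FinSteps (R : ITRS ar X) (d : ℕ) : ℕ → ITerm ar X → ITerm ar X → Prop
  | zero (s : ITerm ar X) : FinSteps R d 0 s s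
  | succ {p : List ℕ} {k : ℕ} {s s' t : ITerm ar X} (hd : d ≤ p.length) (h : R.StepAt p s s')
      (h' : FinSteps R d k s' t) : FinSteps R d (k + 1) s t

/-- `R.Reach d s t`: the term `s` rewrites to `t` by a strongly convergent rewrite sequence with
all steps of depth at least `d`. -/
inductive Reach (R : ITRS ar X) : ℕ → ITerm ar X → ITerm ar X → Prop
  | refl (d : ℕ) (s : ITerm ar X) : Reach R d s s
  | step {d : ℕ} {p : List ℕ} {s t : ITerm ar X} (h : R.StepAt p s t) (hd : d ≤ p.length) :
      Reach R d s t
  | trans {d : ℕ} {s t u : ITerm ar X} (h : Reach R d s t) (h' : Reach R d t u) : Reach R d s u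
  | lim {d : ℕ} {t : ITerm ar X} (f : ℕ → ITerm ar X) (e : ℕ → ℕ)
      (h : ∀ n, Reach R (e n) (f n) (f (n + 1))) (hd : ∀ n, d ≤ e n)
      (he : Filter.Tendsto e Filter.atTop Filter.atTop)
      (ht : ∀ q, ∀ᶠ n in Filter.atTop, f n q = t q) : Reach R d (f 0) t

variable {R : ITRS ar X} {s t u : ITerm ar X} {d k : ℕ}

theorem FinSteps.trans {k' : ℕ} (h : R.FinSteps d k s t) (h' : R.FinSteps d k' t u) :
    R.FinSteps d (k + k') s u := by
  induction h with
  | zero s => simpa using h'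
  | succ hd h _ ih =>
    rw [Nat.succ_add]
    exact .succ hd h (ih h')

theorem FinSteps.reach (h : R.FinSteps d k s t) : R.Reach d s t := by
  induction h with
  | zero s => exact .refl _ _
  | succ hd h _ ih => exact .trans (.step h hd) ih

theorem Reach.mono {d' : ℕ} (h : R.Reach d s t) (hd : d' ≤ d) : R.Reach d' s t := by
  induction h with
  | refl => exact .refl _ _
  | step h hd' => exact .step h (hd.trans hd')
  | trans _ _ ih ih' => exact .trans (ih hd) (ih' hd)
  | lim f e h hd' he ht => exact .lim f e h (fun n => hd.trans (hd' n)) he ht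

theorem StepAt.apply_eq {p q : List ℕ} (h : R.StepAt p s t) (hq : q.length < p.length) :
    t q = s q := by
  obtain ⟨ρ, h⟩ := h.contracts
  refine h.outside q ?_
  rintro _ rfl hpre
  exact absurd hpre.length_le (not_le.2 hq)

theorem Reach.apply_eq (h : R.Reach d s t) : ∀ q : List ℕ, q.length < d → s q = t q := by
  induction h with
  | refl => exact fun _ _ => rfl
  | step h hd => exact fun q hq => (h.apply_eq (hq.trans_le hd)).symm
  | trans _ _ ih ih' => exact fun q hq => (ih q hq).trans (ih' q hq)
  | lim f e h hd he ht ih =>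
    intro q hq
    have h1 : ∀ n, f 0 q = f n q := by
      intro n
      induction n with
      | zero => rfl
      | succ n ihn => exact ihn.trans (ih n q (hq.trans_le (hd n)))
    obtain ⟨n, hn⟩ := (ht q).exists
    exact (h1 n).trans hn

theorem lhs_matches_congr {ρ : IRule ar X} {p : List ℕ} {D : ℕ}
    (hD : ∀ q, (ρ.lhs q).isSome → q.length < D) (h : ρ.lhs.Matches t p)
    (hst : ∀ q : List ℕ, q.length < p.length + D → s q = t q) : ρ.lhs.Matches s p :=
  fun q f hq => by
    rw [hst, h q f hq]
    have := hD q (by simp [hq])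
    rw [List.length_append]
    omega

/-- The redexes still to be contracted are at depth `n` or more and cannot change anything above. -/
theorem Contracts.apply_eq_of_length_lt {U : Set R.Redex} (h : R.Contracts U s t)
    {n : ℕ} {a : ITerm ar X} (ha : R.Contracts {u | u ∈ U ∧ u.1.length < n} s a) {q : List ℕ}
    (hq : q.length < n) : a q = t q := by
  refine ((h.sdiff (fun u hu => hu.1) ha).outside q ?_).symm
  rintro u ⟨hu, hu'⟩ hpre
  exact hu' ⟨hu, hpre.length_le.trans_lt hq⟩

section Finite

variable [Finite F]

/-- A finite signature bounds the arities, so terms are finitely branching. Hence a parallel step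
has only finitely many redexes at each depth, and can be carried out depth by depth in finite
blocks. -/
theorem finite_pos_length (t : ITerm ar X) (n : ℕ) : {p | p ∈ t.pos ∧ p.length = n}.Finite := by
  obtain ⟨N, hN⟩ : ∃ N, ∀ f, ar f ≤ N := by
    obtain ⟨N, hN⟩ := (Set.finite_range ar).bddAbove
    exact ⟨N, fun f => hN ⟨f, rfl⟩⟩
  refine ((List.finite_length_eq (Fin N) n).image (List.map Fin.val)).subset ?_
  rintro p ⟨hp, rfl⟩
  have h : ∀ i ∈ p, i < N := by
    intro i hi
    obtain ⟨a, b, rfl⟩ := List.append_of_mem hi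
    obtain ⟨f, -, hf⟩ := t.exists_fn_of_append_cons hp
    exact hf.trans_le (hN f)
  refine ⟨p.pmap (fun i hi => ⟨i, hi⟩) h, by simp, ?_⟩
  rw [List.map_pmap]
  simp

theorem Contracts.finite_length {U : Set R.Redex} (h : R.Contracts U s t) (n : ℕ) :
    {u | u ∈ U ∧ u.1.length = n}.Finite := by
  have : Finite R.rules := R.rules_finite
  refine ((finite_pos_length s n).prod (Set.finite_univ (α := R.rules))).subset ?_
  rintro u ⟨hu, hn⟩
  exact ⟨⟨isSome_of_lhs_matches (h.lhs_matches u hu), hn⟩, trivial⟩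

/-- A parallel step contracts the redexes at a given depth by a finite rewrite sequence. -/
theorem Contracts.exists_finSteps (hR : R.LeftLinear) {U : Set R.Redex} (h : R.Contracts U s t)
    (hd : ∀ u ∈ U, d ≤ u.1.length) {n : ℕ} {a : ITerm ar X}
    (ha : R.Contracts {u | u ∈ U ∧ u.1.length < n} s a) :
    ∃ b k, R.FinSteps (max d n) k a b ∧ R.Contracts {u | u ∈ U ∧ u.1.length < n + 1} s b := by
  have hfin := h.finite_length n
  -- The redexes of depth `n` are contracted one at a time, by induction on a finite subset of them.
  have key : ∀ C ⊆ {u | u ∈ U ∧ u.1.length = n}, ∃ b k, R.FinSteps (max d n) k a b ∧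
      R.Contracts ({u | u ∈ U ∧ u.1.length < n} ∪ C) s b := by
    intro C hC
    induction C, (hfin.subset hC) using Set.Finite.induction_on with
    | empty => exact ⟨a, 0, .zero a, by simpa using ha⟩
    | @insert w C hw _ ih =>
      obtain ⟨b, k, hb, hb'⟩ := ih ((Set.subset_insert w C).trans hC)
      have hwU := hC (Set.mem_insert w C)
      have hCU : {u | u ∈ U ∧ u.1.length < n} ∪ insert w C ⊆ U := by
        rintro u (hu | hu)
        · exact hu.1
        · exact (hC hu).1
      obtain ⟨c, hc⟩ := h.exists_of_subset hR hCU
      have h1 := hc.sdiff (A := {u | u ∈ U ∧ u.1.length < n} ∪ C)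
        (Set.union_subset_union_right _ (Set.subset_insert w C)) hb'
      have h2 : ({u | u ∈ U ∧ u.1.length < n} ∪ insert w C) \
          ({u | u ∈ U ∧ u.1.length < n} ∪ C) = {w} := by
        ext v
        constructor
        · rintro ⟨hv | rfl | hv, hv'⟩
          · exact absurd (Or.inl hv) hv'
          · rfl
          · exact absurd (Or.inr hv) hv'
        · rintro rfl
          refine ⟨Or.inr (Set.mem_insert _ _), ?_⟩
          rintro (hv | hv)
          · exact absurd hwU.2 hv.2.ne
          · exact hw hv
      rw [h2] at h1
      refine ⟨c, k + 1, hb.trans (.succ ?_ (h1.stepAt hR) (.zero c)), hc⟩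
      exact max_le (hd w hwU.1) hwU.2.ge
  obtain ⟨b, k, hb, hb'⟩ := key _ subset_rfl
  refine ⟨b, k, hb, ?_⟩
  have : {u | u ∈ U ∧ u.1.length < n + 1} =
      {u | u ∈ U ∧ u.1.length < n} ∪ {u | u ∈ U ∧ u.1.length = n} := by
    ext u
    simp only [Set.mem_ofPred_eq, Set.mem_union]
    rw [← and_or_left, Nat.lt_succ_iff_lt_or_eq]
  rw [this]
  exact hb'

theorem Contracts.reach (hR : R.LeftLinear) {U : Set R.Redex} (h : R.Contracts U s t)
    (hd : ∀ u ∈ U, d ≤ u.1.length) : R.Reach d s t := by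
  choose f hf using fun n : ℕ =>
    h.exists_of_subset hR (A := {u | u ∈ U ∧ u.1.length < n}) fun u hu => hu.1
  have h0 : f 0 = s := (hf 0).unique (by simpa using contracts_empty R s)
  rw [← h0]
  refine .lim f (fun n => max d n) (fun n => ?_) (fun n => le_max_left _ _)
    (Filter.tendsto_atTop_mono (fun n => le_max_right d n) Filter.tendsto_id) fun q => ?_
  · obtain ⟨b, k, hb, hb'⟩ := h.exists_finSteps hR hd (hf n)
    rw [(hf (n + 1)).unique hb']
    exact hb.reach
  · filter_upwards [Filter.eventually_gt_atTop q.length] with n hn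
    exact h.apply_eq_of_length_lt (hf n) hn

end Finite

end ITRS

/-! ### Projection over sequences, and compression -/

namespace ITRS

open ITerm Filter

variable {R : ITRS ar X} {s t : ITerm ar X} {U : Set R.Redex}

/-- The limit, along an ultrafilter, of parallel steps. -/
theorem exists_contracts_limit (hR : R.LeftLinear) {f g : ℕ → ITerm ar X} {V : ℕ → Set R.Redex}
    (h : ∀ n, R.Contracts (V n) (f n) (g n)) (hf : ∀ q, ∀ᶠ n in atTop, f n q = t q) :
    ∃ u, R.Contracts {v | ∀ᶠ n in hyperfilter ℕ, v ∈ V n} t u ∧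
      ∀ q, ∀ᶠ n in hyperfilter ℕ, g n q = u q := by
  have hf' : ∀ q, ∀ᶠ n in hyperfilter ℕ, f n q = t q := fun q =>
    (hf q).filter_mono Nat.hyperfilter_le_atTop
  obtain ⟨u, hu⟩ : ∃ u, R.Contracts {v | ∀ᶠ n in hyperfilter ℕ, v ∈ V n} t u := by
    refine exists_contracts hR (fun v hv w hw hvw => ?_) fun v hv q a ha => ?_
    · obtain ⟨n, hn, hn'⟩ := (Eventually.and hv hw).exists
      exact (h n).antichain v hn w hn' hvw
    · obtain ⟨n, hn, hn'⟩ := (Eventually.and hv (hf' (v.1 ++ q))).exists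
      rw [← hn']
      exact (h n).lhs_matches v hn q a ha
  refine ⟨u, hu, fun q => ?_⟩
  by_cases hq : ∃ v, (∀ᶠ n in hyperfilter ℕ, v ∈ V n) ∧ v.1 <+: q
  · obtain ⟨v, hv, a, rfl⟩ := hq
    have hv' : ∀ᶠ n in hyperfilter ℕ, v ∈ V n := hv
    rcases v.2.1.rhs.walk_cases a with ⟨b, hb⟩ | ⟨q, b, x, rfl, hx⟩ | ⟨c, i, d, b, rfl, hb, hi⟩
    · filter_upwards [hv'] with n hn
      rw [(h n).rhs_matches v hn a b hb, hu.rhs_matches v hv a b hb]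
    · obtain ⟨q₀, hq₀⟩ := v.2.1.exists_lhs_var hx
      filter_upwards [hv', hf' (v.1 ++ (q₀ ++ b))] with n hn hn'
      rw [(h n).inside v hn q₀ q x hq₀ hx, hu.inside v hv q₀ q x hq₀ hx, hn']
    · filter_upwards [hv'] with n hn
      rw [((h n).rhs_matches v hn).eq_none hb hi, (hu.rhs_matches v hv).eq_none hb hi]
  · have hfin : {v : R.Redex | v.1 <+: q}.Finite := by
      have : Finite R.rules := R.rules_finite
      have hp : {p | p <+: q}.Finite := by
        refine (q.inits.toFinset.finite_toSet).subset fun p hp => ?_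
        simpa using hp
      exact (hp.prod (Set.finite_univ (α := R.rules))).subset fun v hv => ⟨hv, trivial⟩
    have h1 : ∀ᶠ n in hyperfilter ℕ, ∀ v ∈ {v : R.Redex | v.1 <+: q}, v ∉ V n := by
      refine (eventually_all_finite hfin).2 fun v hv => ?_
      exact Ultrafilter.eventually_not.2 fun hv' => hq ⟨v, hv', hv⟩
    filter_upwards [h1, hf' q] with n hn hn'
    rw [(h n).outside q fun v hv hvq => hn v hvq hv, hn',
      hu.outside q fun v hv hvq => hq ⟨v, hv, hvq⟩]

variable [Finite F] [Countable X] [Infinite X] {D k : ℕ}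

/-- Projecting a parallel step over a single step. -/
theorem StepAt.project (hR : R.WeaklyOrthogonal)
    (hD : ∀ ρ ∈ R.rules, ∀ q, (ρ.lhs q).isSome → q.length < D)
    (hk : ∀ ρ ∈ R.rules, ∀ q x, ρ.rhs q = some (Sum.inr x) → k ≤ q.length)
    {p : List ℕ} {e : ℕ} {s₁ : ITerm ar X} (hs : R.StepAt p s s₁) (he : e ≤ p.length)
    {δ : ℕ} (h : R.Contracts U s t) (hδ : ∀ u ∈ U, δ ≤ u.1.length) :
    ∃ V t', R.Contracts V s₁ t' ∧ R.Reach (max (min e (δ + k)) (e - D)) t t' ∧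
      (∀ v ∈ V, min δ (e + k) ≤ v.1.length) ∧ ((∀ u ∈ U, u.1.length + D ≤ e) → V = U) := by
  obtain ⟨ρ, hv⟩ := hs.contracts
  have hD0 : 0 < D := by
    obtain ⟨f, hf⟩ := ρ.1.lhs_root
    exact hD _ ρ.2 [] (by simp [hf])
  rcases h.project hR hv with ⟨u, hu, hov, h'⟩ | ⟨u, hu, q₀, r, x, hq₀, huv, t', ht', hc⟩ |
    ⟨t', ht', hc⟩
  · refine ⟨U \ {u}, t, h', .refl _ _, fun v hv => (min_le_left _ _).trans (hδ v hv.1),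
      fun hU => ?_⟩
    have h1 := hU u hu
    rcases hov with ⟨a, f, ha, hf⟩ | ha
    · have h2 : p = u.1 ++ a := ha
      have h3 := hD _ u.2.2 a (by simp [hf])
      rw [h2, List.length_append] at he
      omega
    · have h2 : p.length ≤ u.1.length := ha.length_le
      omega
  · have h2 : p = u.1 ++ (q₀ ++ r) := huv
    have h3 := hD _ u.2.2 q₀ (by simp [hq₀])
    have h4 := hδ u hu
    rw [h2, List.length_append, List.length_append] at he
    refine ⟨U, t', ht', hc.reach hR.1 ?_, fun v hv => (min_le_left _ _).trans (hδ v hv),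
      fun _ => rfl⟩
    -- A copy has depth `|u| + |q| + |r|` while `e ≤ |u| + |q₀| + |r|`. From `|q| ≥ k` it is at
    -- least `δ + k`, and from `|q₀| < D` at least `e - D`.
    rintro ⟨w, _⟩ ⟨rfl, q, hq, rfl⟩
    have h5 := hk _ u.2.2 q x hq
    simp only [List.length_append]
    omega
  · refine ⟨_, t', ht', .step (hc.stepAt hR.1) ?_, ?_, fun hU => ?_⟩
    · show _ ≤ p.length
      omega
    · rintro ⟨w, σ⟩ (⟨hw, -⟩ | ⟨q, q', r, x, hq, hq', hw, rfl⟩)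
      · exact (min_le_left _ _).trans (hδ _ hw)
      · have h5 := hk _ ρ.2 q' x hq'
        simp only [List.length_append]
        omega
    · have hno : ∀ u ∈ U, ¬ p <+: u.1 := by
        intro u hu hpre
        have h1 := hU u hu
        have h2 := hpre.length_le
        omega
      ext w
      constructor
      · rintro (⟨hw, -⟩ | ⟨q, q', r, x, hq, hq', hw, -⟩)
        · exact hw
        · exact absurd (List.prefix_append p (q ++ r)) (hno _ hw)
      · exact fun hw => Or.inl ⟨hw, hno w hw⟩

/-- Projecting a parallel step over a rewrite sequence. -/
theorem Reach.project (hR : R.WeaklyOrthogonal)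
    (hD : ∀ ρ ∈ R.rules, ∀ q, (ρ.lhs q).isSome → q.length < D)
    (hk : ∀ ρ ∈ R.rules, ∀ q x, ρ.rhs q = some (Sum.inr x) → k ≤ q.length)
    {e : ℕ} {s₁ : ITerm ar X} (hs : R.Reach e s s₁) :
    ∀ {δ : ℕ} {U : Set R.Redex} {t : ITerm ar X}, R.Contracts U s t →
      (∀ u ∈ U, δ ≤ u.1.length) →
      ∃ V t', R.Contracts V s₁ t' ∧ R.Reach (max (min e (δ + k)) (e - D)) t t' ∧
        (∀ v ∈ V, min δ (e + k) ≤ v.1.length) ∧ ((∀ u ∈ U, u.1.length + D ≤ e) → V = U) := by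
  induction hs with
  | refl e s =>
    intro δ U t h hδ
    exact ⟨U, t, h, .refl _ _, fun v hv => (min_le_left _ _).trans (hδ v hv), fun _ => rfl⟩
  | step hs he =>
    intro δ U t h hδ
    exact hs.project hR hD hk he h hδ
  | trans _ _ ih ih' =>
    intro δ U t h hδ
    obtain ⟨V, t', hV, ht', hVd, hVU⟩ := ih h hδ
    obtain ⟨W, t'', hW, ht'', hWd, hWV⟩ := ih' hV hVd
    refine ⟨W, t'', hW, ht'.trans (ht''.mono ?_), fun w hw => ?_, fun hU => ?_⟩
    · omega
    · have := hWd w hw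
      omega
    · obtain rfl := hVU hU
      exact hWV hU
  | @lim e s₁ f E hs he hE hf ih =>
    intro δ U t h hδ
    -- This bound is invariant along the sequence: `E n ≥ e` gives `min c (E n + k) = c`. The
    -- projected bound does not suffer either, as `min e (δ + k) ≤ c + k`.
    let c := min δ (e + k)
    let S : ℕ → Type _ := fun n => {x : Set R.Redex × ITerm ar X //
      R.Contracts x.1 (f n) x.2 ∧ ∀ u ∈ x.1, c ≤ u.1.length}
    have hstep : ∀ n (x : S n), ∃ y : S (n + 1),
        R.Reach (max (min (E n) (c + k)) (E n - D)) x.1.2 y.1.2 ∧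
        ((∀ u ∈ x.1.1, u.1.length + D ≤ E n) → y.1.1 = x.1.1) := by
      rintro n ⟨⟨V, a⟩, hV, hc⟩
      obtain ⟨V', a', hV', ha', hd', hVV⟩ := ih n hV hc
      refine ⟨⟨⟨V', a'⟩, hV', fun u hu => ?_⟩, ha', hVV⟩
      have h1 := hd' u hu
      have h2 := he n
      omega
    choose nxt hnxt using hstep
    let x : ∀ n, S n := fun n => Nat.rec
      (⟨(U, t), h, fun u hu => (min_le_left _ _).trans (hδ u hu)⟩ : S 0) (fun n y => nxt n y) n
    have hx : ∀ n, x (n + 1) = nxt n (x n) := fun n => rfl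
    obtain ⟨u, hu, hgu⟩ := exists_contracts_limit hR.1 (fun n => (x n).2.1) hf
    have hreach : ∀ n, R.Reach (max (min (E n) (c + k)) (E n - D)) (x n).1.2 (x (n + 1)).1.2 :=
      fun n => (hnxt n (x n)).1
    have hlim : ∀ q, ∀ᶠ n in atTop, (x n).1.2 q = u q := by
      intro q
      -- Projection costs at most `D` in depth, so from `N` on all projected segments stay strictly
      -- below the depth of `q`. The symbol at `q` is then constant, and agreement with `u` for one
      -- large `n`, supplied by the ultrafilter, suffices.
      obtain ⟨N, hN⟩ := eventually_atTop.1 (hE.eventually_ge_atTop (q.length + D + 1))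
      have hconst : ∀ m, (x (N + m)).1.2 q = (x N).1.2 q := by
        intro m
        induction m with
        | zero => rfl
        | succ m ihm =>
          rw [← ihm]
          refine ((hreach (N + m)).apply_eq q ?_).symm
          have := hN (N + m) (Nat.le_add_right _ _)
          omega
      have hev : ∀ᶠ n in hyperfilter ℕ, N ≤ n :=
        (eventually_ge_atTop N).filter_mono Nat.hyperfilter_le_atTop
      obtain ⟨n, hn, hn'⟩ := (hev.and (hgu q)).exists
      obtain ⟨m, rfl⟩ := Nat.exists_eq_add_of_le hn
      filter_upwards [eventually_ge_atTop N] with n hn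
      obtain ⟨m', rfl⟩ := Nat.exists_eq_add_of_le hn
      rw [hconst, ← hn', hconst]
    refine ⟨_, u, hu, ?_, fun v hv => ?_, fun hU => ?_⟩
    · refine Reach.lim (fun n => (x n).1.2) _ hreach (fun n => ?_) ?_ hlim
      · have := he n
        omega
      · refine tendsto_atTop_mono (f := fun n => E n - D) (fun n => le_max_right _ _) ?_
        exact tendsto_atTop.2 fun b => by
          filter_upwards [hE.eventually_ge_atTop (b + D)] with n hn
          omega
    · have hv' : ∀ᶠ n in hyperfilter ℕ, v ∈ (x n).1.1 := hv
      obtain ⟨n, hn⟩ := hv'.exists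
      exact (x n).2.2 v hn
    · have hall : ∀ n, (x n).1.1 = U := by
        intro n
        induction n with
        | zero => rfl
        | succ n ihn =>
          rw [hx, (hnxt n (x n)).2, ihn]
          rw [ihn]
          exact fun u hu => (hU u hu).trans (he n)
      ext v
      simp [hall]

/-- A rewrite sequence can be rearranged into finitely many steps and a sequence of large depth. -/
theorem Reach.exists_finSteps (hR : R.WeaklyOrthogonal)
    (hD : ∀ ρ ∈ R.rules, ∀ q, (ρ.lhs q).isSome → q.length < D) {e : ℕ} (h : R.Reach e s t) :
    ∀ m, ∃ a k, R.FinSteps e k s a ∧ R.Reach m a t := by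
  -- Finitely many steps after a sufficiently deep sequence can be moved in front of it, at the same
  -- positions, leaving a sequence as deep as desired.
  have push : ∀ {n : ℕ} {s t : ITerm ar X}, R.FinSteps e n s t → ∀ m, ∃ m', ∀ s',
      R.Reach m' s' s → ∃ a k, R.FinSteps e k s' a ∧ R.Reach m a t := by
    intro n s t h
    induction h with
    | zero s => exact fun m => ⟨m, fun s' hs' => ⟨s', 0, .zero s', hs'⟩⟩
    | @succ p k s s₁ t hp hs _ ih =>
      intro m
      obtain ⟨m₁, hm₁⟩ := ih m
      -- Depth `p.length + D` keeps the pattern at `p` intact, so that the redex is present in `s'`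
      -- and is its own only residual. Depth `m₁ + D` leaves `m₁` after projection.
      refine ⟨max (m₁ + D) (p.length + D), fun s' hs' => ?_⟩
      obtain ⟨ρ, hρ⟩ := hs.contracts
      have hm : ρ.1.lhs.Matches s' p :=
        lhs_matches_congr (hD _ ρ.2) (hρ.lhs_matches _ rfl) fun q hq =>
          hs'.apply_eq q (hq.trans_le (le_max_right _ _))
      obtain ⟨a, ha⟩ := exists_contracts_singleton hR.1 (p, ρ) hm
      obtain ⟨V, b, hV, hab, -, hVU⟩ := hs'.project (k := 0) (δ := 0) hR hD
        (fun _ _ _ _ _ => Nat.zero_le _) ha (fun _ _ => Nat.zero_le _)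
      obtain rfl := hVU (by rintro _ rfl; exact le_max_right _ _)
      obtain rfl := hV.unique hρ
      obtain ⟨c, k', hc, hct⟩ := hm₁ a (hab.mono (by omega))
      exact ⟨c, k' + 1, .succ hp (ha.stepAt hR.1) hc, hct⟩
  have comp : ∀ {s t u : ITerm ar X}, (∀ m, ∃ a k, R.FinSteps e k s a ∧ R.Reach m a t) →
      (∀ m, ∃ a k, R.FinSteps e k t a ∧ R.Reach m a u) →
      ∀ m, ∃ a k, R.FinSteps e k s a ∧ R.Reach m a u := by
    intro s t u h h' m
    obtain ⟨a, k, ha, hau⟩ := h' m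
    obtain ⟨m', hm'⟩ := push ha m
    obtain ⟨b, k', hb, hbt⟩ := h m'
    obtain ⟨c, k'', hc, hca⟩ := hm' b hbt
    exact ⟨c, k' + k'', hb.trans hc, hca.trans hau⟩
  suffices H : ∀ {e'} {s t : ITerm ar X}, R.Reach e' s t → e ≤ e' →
      ∀ m, ∃ a k, R.FinSteps e k s a ∧ R.Reach m a t from H h le_rfl
  clear h
  intro e' s t h
  induction h with
  | refl e s => exact fun _ m => ⟨s, 0, .zero s, .refl _ _⟩
  | step h hd => exact fun he m => ⟨_, 1, .succ (he.trans hd) h (.zero _), .refl _ _⟩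
  | trans _ _ ih ih' => exact fun he => comp (ih he) (ih' he)
  | @lim d t f E h hd hE hf ih =>
    intro he m
    -- From `N` on all segments have depth at least `m`, so only finitely many segments have to be
    -- rearranged.
    obtain ⟨N, hN⟩ := eventually_atTop.1 (hE.eventually_ge_atTop m)
    have h1 : ∀ n, ∀ m, ∃ a k, R.FinSteps e k (f 0) a ∧ R.Reach m a (f n) := by
      intro n
      induction n with
      | zero => exact fun m => ⟨f 0, 0, .zero _, .refl _ _⟩
      | succ n ihn => exact comp ihn (ih n (he.trans (hd n)))
    obtain ⟨a, k, ha, haN⟩ := h1 N m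
    refine ⟨a, k, ha, haN.trans ?_⟩
    exact Reach.lim (fun n => f (N + n)) (fun n => E (N + n)) (fun n => h (N + n))
      (fun n => hN _ (Nat.le_add_right _ _))
      (hE.comp (tendsto_atTop_mono (fun n => Nat.le_add_left n N) tendsto_id)) fun q =>
      (tendsto_atTop_mono (fun n => Nat.le_add_left n N) tendsto_id).eventually (hf q)

end ITRS

/-! ### The metric in terms of agreement up to a depth -/

namespace ITerm

theorem apply_eq_of_distance_lt {s t : ITerm ar X} {k : ℕ} (h : s.distance t < (2 : ℝ)⁻¹ ^ k)
    {q : List ℕ} (hq : q.length ≤ k) : s q = t q := by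
  by_contra hne
  have hst : s ≠ t := fun h' => hne (by rw [h'])
  rw [distance, if_neg hst] at h
  have hmem : q.length ∈ {k : ℕ | ∃ p : List ℕ, p.length = k ∧ s p ≠ t p} := ⟨q, rfl, hne⟩
  have h1 := (Nat.sInf_le hmem).trans hq
  exact absurd (pow_le_pow_of_le_one (by norm_num) (by norm_num) h1) (not_le.2 h)

theorem distance_le {s t : ITerm ar X} {k : ℕ} (h : ∀ q : List ℕ, q.length < k → s q = t q) :
    s.distance t ≤ (2 : ℝ)⁻¹ ^ k := by
  by_cases hst : s = t
  · rw [distance, if_pos hst]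
    positivity
  · rw [distance, if_neg hst]
    refine pow_le_pow_of_le_one (by norm_num) (by norm_num) ?_
    have hne : {k : ℕ | ∃ p : List ℕ, p.length = k ∧ s p ≠ t p}.Nonempty := by
      by_contra hempty
      refine hst (ext_apply fun p => ?_)
      by_contra hp
      exact hempty ⟨p.length, p, rfl, hp⟩
    obtain ⟨p, hp, hp'⟩ := Nat.sInf_mem hne
    rw [← hp]
    by_contra hlt
    exact hp' (h p (not_le.1 hlt))

end ITerm

/-! ### Passing between ordinal-indexed sequences and reachability -/

namespace ITRS

open ITerm Filter

variable {R : ITRS ar X} {s t : ITerm ar X}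

theorem RewriteSeq.eventually_apply_eq {α : Ordinal.{w}} (κ : R.RewriteSeq s t α)
    {l : Ordinal.{w}} (hl : l ≤ α) (hlim : Order.IsSuccLimit l) (k : ℕ) :
    ∃ γ < l, ∀ β, γ ≤ β → β < l → ∀ q : List ℕ, q.length ≤ k → κ.term β q = κ.term l q := by
  obtain ⟨γ, hγ, h⟩ := κ.tendsto_term l hl hlim ((2 : ℝ)⁻¹ ^ k) (by positivity)
  exact ⟨γ, hγ, fun β hβ hβl q hq => apply_eq_of_distance_lt (h β hβ hβl) hq⟩

/-- At a limit ordinal `l`, countably many stages suffice, even if they are not cofinal: beyond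
suitable stages the terms already agree with `term l` to depth `n` and the steps are at depth at
least `n`. -/
theorem RewriteSeq.reach_term {α : Ordinal.{w}} (κ : R.RewriteSeq s t α) (γ : Ordinal.{w}) :
    γ ≤ α → ∀ β ≤ γ, ∀ d : ℕ, (∀ b, β ≤ b → b < γ → d ≤ (κ.stepPos b).length) →
      R.Reach d (κ.term β) (κ.term γ) := by
  induction γ using Ordinal.limitRecOn with
  | zero =>
    intro _ β hβ d _
    obtain rfl : β = 0 := le_antisymm hβ zero_le
    exact .refl _ _
  | add_one γ ih =>
    intro hγ β hβ d hd
    rw [← Order.succ_eq_add_one] at hγ hβ hd ⊢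
    rcases hβ.lt_or_eq with h | rfl
    · have hβγ : β ≤ γ := Order.lt_succ_iff.1 h
      have hlt : γ < Order.succ γ := Order.lt_succ γ
      exact (ih (hlt.le.trans hγ) β hβγ d fun b hb hb' => hd b hb (hb'.trans hlt)).trans
        (.step (κ.step γ (hlt.trans_le hγ)) (hd γ hβγ hlt))
    · exact .refl _ _
  | limit l hl ih =>
    intro hlα β hβ d hd
    rcases hβ.lt_or_eq with hβl | rfl
    swap
    · exact .refl _ _
    have hG : ∀ n : ℕ, ∃ γ : Set.Iio l, ∀ b, γ.1 ≤ b → b < l → n ≤ (κ.stepPos b).length ∧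
        ∀ q : List ℕ, q.length ≤ n → κ.term b q = κ.term l q := by
      intro n
      obtain ⟨γ, hγ, h⟩ := κ.eventually_apply_eq hlα hl n
      obtain ⟨γ', hγ', h'⟩ := κ.tendsto_depth l hlα hl n
      exact ⟨⟨max γ γ', max_lt hγ hγ'⟩, fun b hb hbl =>
        ⟨h' b ((le_max_right _ _).trans hb) hbl, h b ((le_max_left _ _).trans hb) hbl⟩⟩
    choose G hG using hG
    let c : ℕ → Set.Iio l := fun n => Nat.rec ⟨β, hβl⟩ (fun n x => max x (G n)) n
    have hc : ∀ n, c (n + 1) = max (c n) (G n) := fun n => rfl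
    have hβc : ∀ n, β ≤ (c n).1 := by
      intro n
      induction n with
      | zero => exact le_rfl
      | succ n ihn => exact ihn.trans (hc n ▸ le_max_left (c n) (G n))
    have hGc : ∀ n, (G n).1 ≤ (c (n + 1)).1 := fun n => hc n ▸ le_max_right (c n) (G n)
    -- The shift by one occurs because `c 0 = β` carries no information and `c (n + 1)` is the first
    -- stage past `G n`.
    refine Reach.lim (fun n => κ.term (c n).1) (fun n => max d (n - 1)) (fun n => ?_)
      (fun n => le_max_left _ _) ?_ fun q => ?_
    · refine ih _ (c (n + 1)).2 ((c (n + 1)).2.le.trans hlα) _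
        (hc n ▸ le_max_left (c n) (G n)) _ fun b hb hb' => ?_
      have hbl := hb'.trans (c (n + 1)).2
      refine max_le (hd b ((hβc n).trans hb) hbl) ?_
      cases n with
      | zero => exact Nat.zero_le _
      | succ n => exact (hG n b ((hGc n).trans hb) hbl).1
    · exact tendsto_atTop_mono (fun n => le_max_right _ _) (tendsto_sub_atTop_nat 1)
    · filter_upwards [eventually_ge_atTop (q.length + 1)] with n hn
      obtain ⟨m, rfl⟩ := Nat.exists_eq_add_of_le' (Nat.le_of_add_left_le hn)
      exact (hG m _ (hGc m) (c (m + 1)).2).2 q (Nat.le_of_succ_le_succ hn)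

theorem RewriteSeq.reach {α : Ordinal.{w}} (κ : R.RewriteSeq s t α) {d : ℕ}
    (hd : (d : ℕ∞) ≤ κ.minDepth) : R.Reach d s t := by
  have := κ.reach_term α le_rfl 0 zero_le d fun b _ hb => by
    have h : κ.minDepth ≤ ((κ.stepPos b).length : ℕ∞) := iInf_le (fun β : Set.Iio α =>
      ((κ.stepPos β).length : ℕ∞)) ⟨b, hb⟩
    exact_mod_cast hd.trans h
  rwa [κ.term_zero, κ.term_length] at this

open scoped Classical in
/-- A rewrite sequence of length at most `ω`, from a sequence of terms that is indexed by `ℕ`. -/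
theorem exists_rewriteSeq_of_nat {β : Ordinal.{w}} (hβ : β ≤ Ordinal.omega0) (f : ℕ → ITerm ar X)
    (p : ℕ → List ℕ) {d : ℕ}
    (hstep : ∀ n : ℕ, (n : Ordinal.{w}) < β → R.StepAt (p n) (f n) (f (n + 1)))
    (hd : ∀ n : ℕ, (n : Ordinal.{w}) < β → d ≤ (p n).length)
    (hend : ∀ n : ℕ, β = n → f n = t)
    (hdepth : β = Ordinal.omega0 → ∀ k, ∀ᶠ n in atTop, k ≤ (p n).length)
    (hlim : β = Ordinal.omega0 → ∀ k, ∀ᶠ n in atTop, ∀ q : List ℕ, q.length < k → f n q = t q) :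
    ∃ ξ : R.RewriteSeq (f 0) t β, (d : ℕ∞) ≤ ξ.minDepth := by
  -- Ordinals below `ω` are read as natural numbers through their cardinality; the limit term is put
  -- from `ω` on.
  let T : Ordinal.{w} → ITerm ar X := fun b =>
    if b < Ordinal.omega0 then f (Cardinal.toNat b.card) else t
  let P : Ordinal.{w} → List ℕ := fun b => p (Cardinal.toNat b.card)
  have hT : ∀ n : ℕ, T n = f n := fun n => by simp [T]
  have hP : ∀ n : ℕ, P n = p n := fun n => by simp [P]
  have hTω : T Ordinal.omega0 = t := by simp [T]
  have hnat : ∀ b < β, ∃ n : ℕ, b = n := fun b hb => Ordinal.lt_omega0.1 (hb.trans_le hβ)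
  have hω : ∀ l ≤ β, Order.IsSuccLimit l → β = Ordinal.omega0 ∧ l = Ordinal.omega0 := by
    intro l hl hlim
    have h1 := Ordinal.omega0_le_of_isSuccLimit hlim
    exact ⟨le_antisymm hβ (h1.trans hl), le_antisymm (hl.trans hβ) h1⟩
  refine ⟨{ term := T, stepPos := P, term_zero := ?_, term_length := ?_, step := ?_,
            tendsto_term := ?_, tendsto_depth := ?_ }, ?_⟩
  · exact_mod_cast hT 0
  · rcases hβ.lt_or_eq with h | rfl
    · obtain ⟨n, rfl⟩ := Ordinal.lt_omega0.1 h
      rw [hT]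
      exact hend n rfl
    · exact hTω
  · intro b hb
    obtain ⟨n, rfl⟩ := hnat b hb
    have h1 : Order.succ (n : Ordinal.{w}) = ((n + 1 : ℕ) : Ordinal.{w}) := by simp
    rw [h1, hT, hT, hP]
    exact hstep n hb
  · intro l hl hl' ε hε
    obtain ⟨hβω, rfl⟩ := hω l hl hl'
    obtain ⟨k, hk⟩ := exists_pow_lt_of_lt_one hε (by norm_num : (2 : ℝ)⁻¹ < 1)
    obtain ⟨N, hN⟩ := eventually_atTop.1 (hlim hβω k)
    refine ⟨N, Ordinal.natCast_lt_omega0 N, fun b hb hb' => ?_⟩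
    obtain ⟨n, rfl⟩ := Ordinal.lt_omega0.1 hb'
    rw [hT, hTω]
    exact (distance_le (hN n (by exact_mod_cast hb))).trans_lt hk
  · intro l hl hl' k
    obtain ⟨hβω, rfl⟩ := hω l hl hl'
    obtain ⟨N, hN⟩ := eventually_atTop.1 (hdepth hβω k)
    refine ⟨N, Ordinal.natCast_lt_omega0 N, fun b hb hb' => ?_⟩
    obtain ⟨n, rfl⟩ := Ordinal.lt_omega0.1 hb'
    rw [hP]
    exact hN n (by exact_mod_cast hb)
  · refine le_iInf fun b => ?_
    obtain ⟨n, hn⟩ := hnat b.1 b.2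
    have := hd n (hn ▸ b.2)
    show (d : ℕ∞) ≤ ((P b.1).length : ℕ∞)
    rw [hn, hP]
    exact_mod_cast this

/-- A rewrite sequence of length at most `ω`, from finite rewrite sequences that approximate `t` to
any depth. -/
theorem exists_rewriteSeq_of_finSteps {Good : ℕ → ITerm ar X → Prop} {d : ℕ}
    (hstep : ∀ n a, Good n a → ∃ b k, R.FinSteps (max d n) k a b ∧ Good (n + 1) b)
    (hagree : ∀ n a, Good n a → ∀ q : List ℕ, q.length < n → a q = t q) (h0 : Good 0 s) :
    ∃ (β : Ordinal.{w}) (ξ : R.RewriteSeq s t β), β ≤ Ordinal.omega0 ∧ (d : ℕ∞) ≤ ξ.minDepth := by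
  -- A state consists of the current block `n`, the number of steps left in it, and the current
  -- term.
  let St := {x : ℕ × ℕ × ITerm ar X // ∃ b, R.FinSteps (max d x.1) x.2.1 x.2.2 b ∧ Good (x.1 + 1) b}
  -- Empty blocks have to be skipped, as each index needs a genuine step. If all later blocks were
  -- empty, `a` would be good for every later index and hence equal to `t`.
  have hgood : ∀ n a, Good (n + 1) a → a ≠ t → ∃ n' k' b a' p, n < n' ∧ max d n' ≤ p.length ∧
      R.StepAt p a a' ∧ R.FinSteps (max d n') k' a' b ∧ Good (n' + 1) b := by
    intro n a ha hat
    by_contra hno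
    refine hat (ext_apply fun q => ?_)
    have hall : ∀ m, Good (n + 1 + m) a := by
      intro m
      induction m with
      | zero => exact ha
      | succ m ihm =>
        obtain ⟨b, k, hb, hb'⟩ := hstep _ a ihm
        cases hb with
        | zero => exact hb'
        | succ hp hs h' => exact absurd ⟨_, _, _, _, _, by omega, hp, hs, h', hb'⟩ hno
    exact hagree _ a (hall q.length) q (by omega)
  have hnext : ∀ x : St, x.1.2.2 ≠ t → ∃ (y : St) (p : List ℕ), R.StepAt p x.1.2.2 y.1.2.2 ∧
      max d y.1.1 ≤ p.length ∧ (x.1.1 < y.1.1 ∨ y.1.1 = x.1.1 ∧ y.1.2.1 < x.1.2.1) := by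
    rintro ⟨⟨n, k, a⟩, b, hb, hb'⟩ hat
    cases hb with
    | zero =>
      obtain ⟨n', k', b, a', p, hn, hp, hs, h', hg⟩ := hgood n a hb' hat
      exact ⟨⟨(n', k', a'), b, h', hg⟩, p, hs, hp, Or.inl hn⟩
    | @succ _ k' _ _ _ hp hs h' =>
      exact ⟨⟨(n, k', _), b, h', hb'⟩, _, hs, hp, Or.inr ⟨rfl, Nat.lt_succ_self k'⟩⟩
  have hnext' : ∀ x : St, ∃ y : St × List ℕ, x.1.2.2 ≠ t → R.StepAt y.2 x.1.2.2 y.1.1.2.2 ∧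
      max d y.1.1.1 ≤ y.2.length ∧ (x.1.1 < y.1.1.1 ∨ y.1.1.1 = x.1.1 ∧ y.1.1.2.1 < x.1.2.1) := by
    intro x
    by_cases hx : x.1.2.2 = t
    · exact ⟨(x, []), fun h => absurd hx h⟩
    · obtain ⟨y, p, h⟩ := hnext x hx
      exact ⟨(y, p), fun _ => h⟩
  choose nxt hnxt using hnext'
  obtain ⟨b₀, k₀, hb₀, hb₀'⟩ := hstep 0 s h0
  let x : ℕ → St := fun j => Nat.rec ⟨(0, k₀, s), b₀, hb₀, hb₀'⟩ (fun _ y => (nxt y).1) j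
  have hx : ∀ j, x (j + 1) = (nxt (x j)).1 := fun _ => rfl
  let f : ℕ → ITerm ar X := fun j => (x j).1.2.2
  have hxs : ∀ j, f j ≠ t → R.StepAt (nxt (x j)).2 (f j) (f (j + 1)) ∧
      max d (x (j + 1)).1.1 ≤ (nxt (x j)).2.length ∧
      ((x j).1.1 < (x (j + 1)).1.1 ∨
        (x (j + 1)).1.1 = (x j).1.1 ∧ (x (j + 1)).1.2.1 < (x j).1.2.1) :=
    fun j hj => hnxt (x j) hj
  -- The sequence stops as soon as `t` is met; otherwise it has length `ω`.
  by_cases hJ : ∃ J, f J = t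
  · classical
    refine ⟨Nat.find hJ, ?_⟩
    have hlt : ∀ n : ℕ, (n : Ordinal.{w}) < Nat.find hJ → f n ≠ t := fun n hn =>
      Nat.find_min hJ (by exact_mod_cast hn)
    have hne : ((Nat.find hJ : ℕ) : Ordinal.{w}) ≠ Ordinal.omega0 :=
      (Ordinal.natCast_lt_omega0 _).ne
    obtain ⟨ξ, hξ⟩ := exists_rewriteSeq_of_nat (R := R) (t := t)
      (Ordinal.natCast_lt_omega0 (Nat.find hJ)).le f (fun j => (nxt (x j)).2) (d := d)
      (fun n hn => (hxs n (hlt n hn)).1)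
      (fun n hn => (le_max_left _ _).trans (hxs n (hlt n hn)).2.1)
      (fun n hn => by
        have h1 : Nat.find hJ = n := by exact_mod_cast hn
        rw [← h1]
        exact Nat.find_spec hJ)
      (fun h => absurd h hne) (fun h => absurd h hne)
    exact ⟨ξ, (Ordinal.natCast_lt_omega0 _).le, hξ⟩
  · have hne : ∀ j, f j ≠ t := fun j hj => hJ ⟨j, hj⟩
    have hmono : Monotone fun j => (x j).1.1 := monotone_nat_of_le_succ fun j => by
      rcases (hxs j (hne j)).2.2 with h | h
      · exact h.le
      · exact h.1.ge
    -- The number of steps left decreases within a block, so every block is eventually left, and the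
    -- depths tend to infinity.
    have hprog : ∀ k j, (x j).1.2.1 = k → ∃ j', (x j).1.1 < (x j').1.1 := by
      intro k
      induction k using Nat.strong_induction_on with
      | _ k ihk =>
        intro j hj
        rcases (hxs j (hne j)).2.2 with h | ⟨h, h'⟩
        · exact ⟨j + 1, h⟩
        · obtain ⟨j', hj'⟩ := ihk _ (hj ▸ h') (j + 1) rfl
          exact ⟨j', h ▸ hj'⟩
    have htend : Tendsto (fun j => (x j).1.1) atTop atTop := by
      refine tendsto_atTop_atTop_of_monotone hmono fun M => ?_
      induction M with
      | zero => exact ⟨0, Nat.zero_le _⟩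
      | succ M ihM =>
        obtain ⟨j, hj⟩ := ihM
        obtain ⟨j', hj'⟩ := hprog _ j rfl
        exact ⟨j', hj.trans_lt hj'⟩
    refine ⟨Ordinal.omega0, ?_⟩
    obtain ⟨ξ, hξ⟩ := exists_rewriteSeq_of_nat (R := R) (t := t) le_rfl f
      (fun j => (nxt (x j)).2) (d := d)
      (fun n _ => (hxs n (hne n)).1)
      (fun n _ => (le_max_left _ _).trans (hxs n (hne n)).2.1)
      (fun n hn => absurd hn (Ordinal.natCast_lt_omega0 _).ne')
      (fun _ k => by
        filter_upwards [htend.eventually_ge_atTop k] with n hn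
        exact hn.trans ((hmono n.le_succ).trans
          ((le_max_right _ _).trans (hxs n (hne n)).2.1)))
      (fun _ k => by
        filter_upwards [htend.eventually_ge_atTop k] with n hn q hq
        obtain ⟨b, hb, hb'⟩ := (x n).2
        have hq' := hq.trans_le hn
        rw [← hagree _ b hb' q (hq'.trans (Nat.lt_succ_self _))]
        exact hb.reach.apply_eq q (hq'.trans_le (le_max_right _ _)))
    exact ⟨ξ, le_rfl, hξ⟩

/-- Repeated rearrangement: after block `n` the rest of the reduction to `t` has depth at least `n +
1`, so the current term agrees with `t` above that depth. -/
theorem Reach.exists_rewriteSeq [Finite F] [Countable X] [Infinite X] (hR : R.WeaklyOrthogonal)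
    {D d : ℕ} (hD : ∀ ρ ∈ R.rules, ∀ q, (ρ.lhs q).isSome → q.length < D) (h : R.Reach d s t) :
    ∃ (β : Ordinal.{w}) (ξ : R.RewriteSeq s t β), β ≤ Ordinal.omega0 ∧ (d : ℕ∞) ≤ ξ.minDepth := by
  refine exists_rewriteSeq_of_finSteps (Good := fun n a => R.Reach (max d n) a t)
    (fun n a ha => ?_) (fun n a ha q hq => ha.apply_eq q (hq.trans_le (le_max_right _ _)))
    (by simpa using h)
  obtain ⟨b, k, hb, hb'⟩ := ha.exists_finSteps hR hD (max d (n + 1))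
  exact ⟨b, k, hb, hb'⟩

theorem Contracts.exists_rewriteSeq [Finite F] (hR : R.LeftLinear) {U : Set R.Redex}
    (h : R.Contracts U s t) : ∃ α : Ordinal.{w}, Nonempty (R.RewriteSeq s t α) := by
  obtain ⟨β, ξ, -, -⟩ := exists_rewriteSeq_of_finSteps.{u, v, w} (R := R) (s := s) (t := t) (d := 0)
    (Good := fun n a => R.Contracts {u | u ∈ U ∧ u.1.length < n} s a)
    (fun n a ha => h.exists_finSteps hR (fun _ _ => Nat.zero_le _) ha)
    (fun n a ha q hq => h.apply_eq_of_length_lt ha hq)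
    (by simpa using contracts_empty R s)
  exact ⟨β, ⟨ξ⟩⟩

end ITRS

/-! ### Labelled developments -/

namespace ITerm

variable {F' : Type*} {ar' : F' → ℕ} {t : ITerm ar X} {g : List ℕ → F → F'}
  {hg : ∀ p f, ar' (g p f) = ar f}

theorem relabel_eq_var {p : List ℕ} {x : X} :
    t.relabel g hg p = some (Sum.inr x) ↔ t p = some (Sum.inr x) := by
  rcases h : t.toFun p with _ | f | y <;> simp [relabel, h]

theorem relabel_eq_fn {p : List ℕ} {f' : F'} :
    t.relabel g hg p = some (Sum.inl f') ↔ ∃ f, t p = some (Sum.inl f) ∧ g p f = f' := by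
  rcases h : t.toFun p with _ | f | y <;> simp [relabel, h]

end ITerm

namespace ITRS

open ITerm

variable {R : ITRS ar X} {s t : ITerm ar X} {U : Set R.Redex}

theorem unlabelled_apply (t : ITerm ar X) (p : List ℕ) :
    R.unlabelled t p = (t p).map (Sum.map Sum.inl id) := rfl

theorem unlabelled_injective : Function.Injective (R.unlabelled : ITerm ar X → _) := by
  intro s t h
  refine ext_apply fun p => ?_
  have h' : R.unlabelled s p = R.unlabelled t p := by rw [h]
  rw [unlabelled_apply, unlabelled_apply] at h'
  exact Option.map_injective (Sum.map_injective.2 ⟨Sum.inl_injective, Function.injective_id⟩) h'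

theorem unlabelled_ne {p : List ℕ} {f : F} {ρ : R.rules} :
    R.unlabelled t p ≠ some (Sum.inl (Sum.inr (f, ρ))) := by
  intro h
  obtain ⟨g, -, hg⟩ := relabel_eq_fn.1 h
  simp at hg

theorem mem_of_labelTerm_eq {p : List ℕ} {f : F} {ρ : R.rules}
    (h : R.labelTerm t U p = some (Sum.inl (Sum.inr (f, ρ)))) : (p, ρ) ∈ U := by
  obtain ⟨g, -, hg⟩ := relabel_eq_fn.1 h
  unfold redexLabel at hg
  split at hg
  · rename_i h'
    have : h'.choose = ρ := by simpa using congrArg (Sum.elim (fun _ => h'.choose) Prod.snd) hg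
    rw [← this]
    exact h'.choose_spec
  · simp at hg

theorem labelTerm_apply_of_notMem {p : List ℕ} (h : ∀ ρ, (p, ρ) ∉ U) :
    R.labelTerm t U p = R.unlabelled t p := by
  have h' : ¬ ∃ ρ, (p, ρ) ∈ U := fun ⟨ρ, hρ⟩ => h ρ hρ
  rcases ht : t.toFun p with _ | f | x <;>
    simp [labelTerm, unlabelled, relabel, ht, redexLabel, h']

theorem lhs_eq_var_of_labelledRule {ρ : R.rules} {p : List ℕ} {x : X}
    (h : (R.labelledRule ρ).lhs p = some (Sum.inr x)) : ρ.1.lhs p = some (Sum.inr x) :=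
  (relabel_eq_var (hg := R.labelledArity_rootLabel ρ)).1 h

theorem rhs_eq_var_of_labelledRule {ρ : R.rules} {p : List ℕ} {x : X}
    (h : (R.labelledRule ρ).rhs p = some (Sum.inr x)) : ρ.1.rhs p = some (Sum.inr x) :=
  (relabel_eq_var (hg := fun _ f => R.labelledArity_inl f)).1 h

theorem labelledRule_lhs_root {ρ : R.rules} {f : F} (h : ρ.1.lhs [] = some (Sum.inl f)) :
    (R.labelledRule ρ).lhs [] = some (Sum.inl (Sum.inr (f, ρ))) :=
  (relabel_eq_fn (hg := R.labelledArity_rootLabel ρ)).2 ⟨f, h, by rw [rootLabel, if_pos rfl]⟩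

theorem labelled_leftLinear (hR : R.LeftLinear) : R.labelled.LeftLinear := by
  rintro _ ⟨ρ, rfl⟩ p q x hp hq
  exact hR _ ρ.2 p q x (lhs_eq_var_of_labelledRule hp)
    (lhs_eq_var_of_labelledRule hq)

/-- A redex, seen as a redex of the labelled system. -/
noncomputable def labelRedex (u : R.Redex) : R.labelled.Redex :=
  (u.1, ⟨R.labelledRule u.2, u.2, rfl⟩)

/-- Since the redexes are disjoint, the only label inside a redex is at its root. The subterms that
are moved carry no labels, and contracting all redexes leaves none. -/
theorem Contracts.labelled (h : R.Contracts U s t) :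
    R.labelled.Contracts (labelRedex '' U) (R.labelTerm s U) (R.unlabelled t) := by
  have hbelow : ∀ u ∈ U, ∀ q ≠ [], R.labelTerm s U (u.1 ++ q) = R.unlabelled s (u.1 ++ q) := by
    intro u hu q hq
    refine labelTerm_apply_of_notMem fun ρ hρ => hq ?_
    have h1 := h.antichain u hu _ hρ (List.prefix_append _ _)
    have h2 := congrArg Prod.fst h1
    simpa using h2
  have hroot : ∀ u ∈ U, ∀ f, s u.1 = some (Sum.inl f) →
      R.labelTerm s U u.1 = some (Sum.inl (Sum.inr (f, u.2))) := by
    intro u hu f hf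
    refine relabel_eq_fn.2 ⟨f, hf, ?_⟩
    have h' : ∃ ρ, (u.1, ρ) ∈ U := ⟨u.2, hu⟩
    have h1 := h.antichain u hu _ h'.choose_spec (List.prefix_refl _)
    have h2 : u.2 = h'.choose := congrArg Prod.snd h1
    rw [redexLabel, dif_pos h', h2]
  refine ⟨?_, ?_, fun q hq => ?_, ?_, ?_⟩
  · rintro _ ⟨u, hu, rfl⟩ _ ⟨v, hv, rfl⟩ huv
    rw [h.antichain u hu v hv huv]
  · rintro _ ⟨u, hu, rfl⟩ q l hq
    obtain ⟨f, hf, rfl⟩ := (relabel_eq_fn (hg := R.labelledArity_rootLabel u.2)).1 hq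
    have hs := h.lhs_matches u hu q f hf
    show R.labelTerm s U (u.1 ++ q) = _
    by_cases hq0 : q = []
    · subst hq0
      rw [List.append_nil] at hs ⊢
      rw [hroot u hu f hs, rootLabel, if_pos rfl]
    · rw [hbelow u hu q hq0, rootLabel, if_neg hq0]
      exact relabel_eq_fn.2 ⟨f, hs, rfl⟩
  · rw [labelTerm_apply_of_notMem fun ρ hρ => hq _ ⟨_, hρ, rfl⟩ (List.prefix_refl _),
      unlabelled_apply, unlabelled_apply, h.outside q fun u hu => hq _ ⟨u, hu, rfl⟩]
  · rintro _ ⟨u, hu, rfl⟩ q l hq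
    obtain ⟨f, hf, rfl⟩ := (relabel_eq_fn (hg := fun _ f => R.labelledArity_inl f)).1 hq
    exact relabel_eq_fn.2 ⟨f, h.rhs_matches u hu q f hf, rfl⟩
  · rintro _ ⟨u, hu, rfl⟩ q₀ q x hq₀ hq w
    have hq₀' := lhs_eq_var_of_labelledRule hq₀
    have hne : q₀ ≠ [] := by
      rintro rfl
      obtain ⟨f, hf⟩ := u.2.1.lhs_root
      rw [hf] at hq₀'
      simp at hq₀'
    have h1 := h.inside u hu q₀ q x hq₀' (rhs_eq_var_of_labelledRule hq) w
    exact (congrArg (Option.map (Sum.map Sum.inl id)) h1).trans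
      (hbelow u hu (q₀ ++ w) (by simp [hne])).symm

/-- Along a labelled rewrite sequence, every labelled redex is either untouched or contracted. -/
theorem RewriteSeq.labelled_invariant (h : R.Contracts U s t) {t' : ITerm R.labelledArity X}
    {α : Ordinal.{w}} (κ : R.labelled.RewriteSeq (R.labelTerm s U) t' α) (γ : Ordinal.{w}) :
    γ ≤ α → (∀ q, (∀ u ∈ U, ¬ u.1 <+: q) → κ.term γ q = R.labelTerm s U q) ∧
      ∀ u ∈ U, (∀ q, κ.term γ (u.1 ++ q) = R.labelTerm s U (u.1 ++ q)) ∨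
        ∀ q, κ.term γ (u.1 ++ q) = R.unlabelled t (u.1 ++ q) := by
  induction γ using Ordinal.limitRecOn with
  | zero =>
    intro _
    rw [κ.term_zero]
    exact ⟨fun _ _ => rfl, fun _ _ => Or.inl fun _ => rfl⟩
  | add_one γ ih =>
    intro hγ
    rw [← Order.succ_eq_add_one] at hγ ⊢
    have hlt := Order.succ_le_iff.1 hγ
    obtain ⟨hout, hin⟩ := ih hlt.le
    obtain ⟨⟨_, ρ, rfl⟩, hv⟩ := (κ.step γ hlt).contracts
    obtain ⟨f, hf⟩ := ρ.1.lhs_root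
    have hroot : κ.term γ (κ.stepPos γ) = some (Sum.inl (Sum.inr (f, ρ))) := by
      have := hv.lhs_matches _ rfl [] (Sum.inr (f, ρ))
        (labelledRule_lhs_root hf)
      rwa [List.append_nil] at this
    -- A labelled step needs a label at its position, and by the induction hypothesis labels are
    -- left only at the roots of intact redexes of `U`.
    have hU : (κ.stepPos γ, ρ) ∈ U ∧
        ∀ q, κ.term γ (κ.stepPos γ ++ q) = R.labelTerm s U (κ.stepPos γ ++ q) := by
      by_cases hp : ∃ u ∈ U, u.1 <+: κ.stepPos γ
      · obtain ⟨u, hu, a, ha⟩ := hp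
        rw [← ha] at hroot ⊢
        rcases hin u hu with hS | hT
        · rw [hS] at hroot
          have hmem := mem_of_labelTerm_eq hroot
          have h1 := congrArg Prod.fst (h.antichain u hu _ hmem (List.prefix_append _ _))
          obtain rfl : a = [] := by simpa using h1
          rw [List.append_nil] at hmem ⊢
          exact ⟨hmem, hS⟩
        · rw [hT] at hroot
          exact absurd hroot unlabelled_ne
      · have hp' : ∀ u ∈ U, ¬ u.1 <+: κ.stepPos γ := fun u hu h' => hp ⟨u, hu, h'⟩
        rw [hout _ hp'] at hroot
        exact absurd (List.prefix_refl _) (hp' _ (mem_of_labelTerm_eq hroot))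
    obtain ⟨hmem, hS⟩ := hU
    refine ⟨fun q hq => ?_, fun u hu => ?_⟩
    · rw [hv.outside q (by simpa using hq _ hmem), hout q hq]
    · by_cases huv : u = (κ.stepPos γ, ρ)
      · subst huv
        refine Or.inr fun q => ?_
        refine (hv.rhs_matches _ rfl).apply_eq (h.labelled.rhs_matches _ ⟨_, hmem, rfl⟩) q
          fun q b x _ hx => ?_
        obtain ⟨q₀, hq₀⟩ := (R.labelledRule ρ).exists_lhs_var hx
        rw [hv.inside _ rfl q₀ q x hq₀ hx b, hS]
        exact (h.labelled.inside _ ⟨_, hmem, rfl⟩ q₀ q x hq₀ hx b).symm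
      · have hout' : ∀ q, κ.term (Order.succ γ) (u.1 ++ q) = κ.term γ (u.1 ++ q) := by
          refine fun q => hv.outside _ ?_
          rintro _ rfl hpre
          exact huv (h.eq_of_comparable hu hmem
            (List.prefix_or_prefix_of_prefix (List.prefix_append _ _) hpre))
        exact (hin u hu).imp (fun h' q => (hout' q).trans (h' q))
          fun h' q => (hout' q).trans (h' q)
  | limit l hl ih =>
    intro hlα
    refine ⟨fun q hq => ?_, fun u hu => ?_⟩
    · obtain ⟨γ, hγ, h'⟩ := κ.eventually_apply_eq hlα hl q.length
      rw [← h' γ le_rfl hγ q le_rfl]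
      exact (ih γ hγ (hγ.le.trans hlα)).1 q hq
    -- If both alternatives failed at the limit, two positions would witness this, and an earlier
    -- term agrees with the limit at both.
    · by_contra! hno
      obtain ⟨⟨q, hq⟩, q', hq'⟩ := hno
      obtain ⟨γ, hγ, h'⟩ := κ.eventually_apply_eq hlα hl
        (max (u.1 ++ q).length (u.1 ++ q').length)
      rw [← h' γ le_rfl hγ _ (le_max_left _ _)] at hq
      rw [← h' γ le_rfl hγ _ (le_max_right _ _)] at hq'
      exact ((ih γ hγ (hγ.le.trans hlα)).2 u hu).elim (fun h' => hq (h' q)) fun h' => hq' (h' q')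

/-- The last term of the development has no labels, which excludes intact redexes; so every redex of
`U` has been contracted. -/
theorem ParallelStep.contracts (hR : R.LeftLinear) (h : R.ParallelStep U s t) :
    R.Contracts U s t := by
  obtain ⟨hanti, ⟨hred, -⟩, α, ⟨κ⟩⟩ := h
  have hm : ∀ u ∈ U, u.2.1.lhs.Matches s u.1 := fun u hu => (isRedexIn_iff hR u).1 (hred u hu)
  obtain ⟨t', ht'⟩ := exists_contracts hR (U := U) (s := s)
    (fun u hu v hv huv => by
      by_contra hne
      exact (hanti u hu v hv hne).1 huv) hm
  obtain ⟨hout, hin⟩ := κ.labelled_invariant ht' α le_rfl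
  rw [κ.term_length] at hout hin
  have htt : R.unlabelled t = R.unlabelled t' := by
    refine ext_apply fun q => ?_
    by_cases hq : ∃ u ∈ U, u.1 <+: q
    · obtain ⟨u, hu, a, rfl⟩ := hq
      rcases hin u hu with hS | hT
      · obtain ⟨f, hf⟩ := u.2.1.lhs_root
        have h1 := ht'.labelled.lhs_matches _ ⟨u, hu, rfl⟩ [] (Sum.inr (f, u.2))
          (labelledRule_lhs_root hf)
        exact absurd ((hS []).trans h1) unlabelled_ne
      · exact hT a
    · have hq' : ∀ u ∈ U, ¬ u.1 <+: q := fun u hu h' => hq ⟨u, hu, h'⟩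
      rw [hout q hq', labelTerm_apply_of_notMem fun ρ hρ => hq' _ hρ (List.prefix_refl _),
        unlabelled_apply, unlabelled_apply, ht'.outside q hq']
  rw [unlabelled_injective htt]
  exact ht'

theorem Contracts.parallelStep [Finite F] (hR : R.LeftLinear) (h : R.Contracts U s t) :
    R.ParallelStep U s t := by
  have : Finite R.rules := R.rules_finite
  have : Finite R.LabelledSymbol := inferInstanceAs (Finite (F ⊕ F × R.rules))
  refine ⟨fun u hu v hv huv => ⟨fun h' => huv (h.antichain u hu v hv h'),
    fun h' => huv (h.antichain v hv u hu h').symm⟩, ⟨fun u hu =>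
    (isRedexIn_iff hR u).2 (h.lhs_matches u hu), fun u hu v hv huv => ?_⟩,
    h.labelled.exists_rewriteSeq (labelled_leftLinear hR)⟩
  refine Set.disjoint_left.2 ?_
  rintro _ ⟨q, f, -, rfl⟩ ⟨q', f', -, hq'⟩
  exact huv (h.eq_of_comparable hu hv 
    (prefix_comparable ⟨[], (List.append_nil _).trans hq'⟩))

/-! ### The parallel moves lemma with depth bounds -/

theorem exists_lhs_length_lt (R : ITRS ar X) :
    ∃ D, ∀ ρ ∈ R.rules, ∀ q, (ρ.lhs q).isSome → q.length < D := by
  have hfin : (⋃ ρ ∈ R.rules, ρ.lhs.pos).Finite :=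
    R.rules_finite.biUnion fun ρ _ => ρ.lhs_finite
  obtain ⟨N, hN⟩ := (hfin.image List.length).bddAbove
  refine ⟨N + 1, fun ρ hρ q hq => Nat.lt_succ_of_le (hN ⟨q, ?_, rfl⟩)⟩
  exact Set.mem_biUnion hρ hq

theorem le_redexDepth {d : ℕ∞} (h : ∀ u ∈ U, d ≤ (u.1.length : ℕ∞)) : d ≤ redexDepth U :=
  le_iInf fun u => h u.1 u.2

theorem redexDepth_le {u : R.Redex} (h : u ∈ U) : redexDepth U ≤ (u.1.length : ℕ∞) :=
  iInf_le (fun u : U => (u.1.1.length : ℕ∞)) ⟨u, h⟩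

/-- The parallel moves lemma, for a lower bound `k` of the depths of variables in right-hand
sides. -/
theorem parallel_moves [Finite F] [Countable X] [Infinite X] (hR : R.WeaklyOrthogonal) {k : ℕ}
    (hk : ∀ ρ ∈ R.rules, ∀ q x, ρ.rhs q = some (Sum.inr x) → k ≤ q.length)
    {t₁ t₂ : ITerm ar X} {α : Ordinal.{w}} (κ : R.RewriteSeq s t₁ α) (h : R.Contracts U s t₂) :
    ∃ (u : ITerm ar X) (β : Ordinal.{w}) (ξ : R.RewriteSeq t₂ u β) (V : Set R.Redex),
      β ≤ Ordinal.omega0 ∧ R.Contracts V t₁ u ∧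
      min κ.minDepth (redexDepth U + k) ≤ ξ.minDepth ∧
      min (redexDepth U) (κ.minDepth + k) ≤ redexDepth V := by
  -- The empty sequence has minimal depth `⊤`, which `Reach` with its natural bounds does not
  -- express.
  rcases eq_or_ne α 0 with rfl | hα
  · have hst : s = t₁ := κ.term_zero.symm.trans κ.term_length
    have hno : ∀ b : Ordinal.{w}, ¬ b < 0 := fun b => not_lt_zero
    have hno' : ∀ l : Ordinal.{w}, l ≤ 0 → ¬ Order.IsSuccLimit l := fun l hl hl' =>
      hno _ (Ordinal.omega0_pos.trans_le ((Ordinal.omega0_le_of_isSuccLimit hl').trans hl))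
    let ξ : R.RewriteSeq t₂ t₂ (0 : Ordinal.{w}) :=
      { term := fun _ => t₂
        stepPos := fun _ => []
        term_zero := rfl
        term_length := rfl
        step := fun b hb => absurd hb (hno b)
        tendsto_term := fun l hl hl' => absurd hl' (hno' l hl)
        tendsto_depth := fun l hl hl' => absurd hl' (hno' l hl) }
    exact ⟨t₂, 0, ξ, U, zero_le, hst ▸ h, le_iInf fun b => absurd b.2 (hno b.1), min_le_left _ _⟩
  · have hfin : κ.minDepth ≠ ⊤ := by
      have h1 : κ.minDepth ≤ ((κ.stepPos 0).length : ℕ∞) :=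
        iInf_le (fun β : Set.Iio α => ((κ.stepPos β).length : ℕ∞)) ⟨0, pos_iff_ne_zero.2 hα⟩
      exact ne_top_of_le_ne_top (ENat.natCast_ne_top _) h1
    obtain ⟨e, he⟩ := ENat.ne_top_iff_exists.1 hfin
    rw [← he]
    -- The depth of `U` is infinite if `U` is empty. Truncating it at `e + k` keeps it natural and
    -- loses nothing in either bound.
    have hfin' : min (redexDepth U) ((e : ℕ∞) + k) ≠ ⊤ :=
      ne_top_of_le_ne_top (by exact_mod_cast ENat.natCast_ne_top (e + k)) (min_le_right _ _)
    obtain ⟨δ, hδ⟩ := ENat.ne_top_iff_exists.1 hfin'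
    obtain ⟨D, hD⟩ := R.exists_lhs_length_lt
    have hδU : ∀ u ∈ U, δ ≤ u.1.length := fun u hu => by
      have : (δ : ℕ∞) ≤ (u.1.length : ℕ∞) := hδ ▸ (min_le_left _ _).trans (redexDepth_le hu)
      exact_mod_cast this
    obtain ⟨V, u, hV, hreach, hVd, -⟩ := (κ.reach he.le).project hR hD hk h hδU
    obtain ⟨β, ξ, hβ, hξ⟩ := (hreach.mono (le_max_left _ _)).exists_rewriteSeq.{u, v, w} hR hD
    refine ⟨u, β, ξ, V, hβ, hV, le_trans ?_ hξ, ?_⟩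
    · rw [Nat.mono_cast.map_min, Nat.cast_add, hδ, ← min_add_add_right]
      refine le_min (min_le_left _ _) (le_min (min_le_right _ _) ((min_le_left _ _).trans ?_))
      rw [add_assoc]
      exact le_self_add
    · refine le_redexDepth fun v hv => ?_
      have h1 : ((min δ (e + k) : ℕ) : ℕ∞) ≤ (v.1.length : ℕ∞) := by exact_mod_cast hVd v hv
      refine le_trans ?_ h1
      rw [Nat.mono_cast.map_min, Nat.cast_add, hδ]
      exact le_min le_rfl (min_le_right _ _)

theorem NonCollapsing.one_le_length (h : R.NonCollapsing) :
    ∀ ρ ∈ R.rules, ∀ q x, ρ.rhs q = some (Sum.inr x) → 1 ≤ q.length := by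
  intro ρ hρ q x hq
  cases q with
  | cons i q => simp
  | nil =>
    refine absurd ⟨x, ext_apply fun p => ?_⟩ (h ρ hρ)
    cases p with
    | nil => exact hq
    | cons i p =>
      by_contra hne
      have h1 := ρ.rhs.eq_nil_of_var hq (q := i :: p) (Option.isSome_iff_ne_none.2 hne)
      simp at h1

end ITRS

end

theorem mainTheorem8 {F : Type u} [Finite F] {ar : F → ℕ} {X : Type v}
    [Countable X] [Infinite X] (R : ITRS ar X) (hR : R.WeaklyOrthogonal)
    {s t₁ t₂ : ITerm ar X} {α : Ordinal.{w}} (κ : R.RewriteSeq s t₁ α)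
    (U : Set R.Redex) (hφ : R.ParallelStep U s t₂) :
    ∃ (u : ITerm ar X) (β : Ordinal.{w}) (ξ : R.RewriteSeq t₂ u β) (V : Set R.Redex),
      β ≤ Ordinal.omega0 ∧
      R.ParallelStep V t₁ u ∧
      min κ.minDepth (ITRS.redexDepth U) ≤ ξ.minDepth ∧
      min κ.minDepth (ITRS.redexDepth U) ≤ ITRS.redexDepth V ∧
      (R.NonCollapsing →
        min κ.minDepth (ITRS.redexDepth U + 1) ≤ ξ.minDepth ∧
        min (ITRS.redexDepth U) (κ.minDepth + 1) ≤ ITRS.redexDepth V) := by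
  have h := hφ.contracts hR.1
  -- One choice of `u`, `ξ` and `V` has to satisfy all the bounds. Without collapsing rules `k = 1`
  -- is used, and its bounds imply the weaker ones.
  by_cases hN : R.NonCollapsing
  · obtain ⟨u, β, ξ, V, hβ, hV, hξ, hVd⟩ := ITRS.parallel_moves hR hN.one_le_length κ h
    rw [Nat.cast_one] at hξ hVd
    refine ⟨u, β, ξ, V, hβ, hV.parallelStep hR.1, le_trans ?_ hξ, le_trans ?_ hVd,
      fun _ => ⟨hξ, hVd⟩⟩
    · exact min_le_min_left _ le_self_add
    · rw [min_comm]
      exact min_le_min_left _ le_self_add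
  · obtain ⟨u, β, ξ, V, hβ, hV, hξ, hVd⟩ :=
      ITRS.parallel_moves hR (k := 0) (fun _ _ _ _ _ => Nat.zero_le _) κ h
    rw [Nat.cast_zero, add_zero] at hξ hVd
    rw [min_comm] at hVd
    exact ⟨u, β, ξ, V, hβ, hV.parallelStep hR.1, hξ, hVd, fun h' => absurd h' hN⟩
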